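/- **Setting.** Let $\mathcal K=\{1,\dots,k_\circ\}$, let $Q=[q_{ij}]$ be an irreducible stochastic rate matrix on $\mathcal K$ with invariant probability distribution $\pi$, let $\alpha>0$ and $\beta=\max\{\tfrac12,1-\tfrac\alpha2\}$. For $n\in\mathbb N=\{1,2,\dots\}$ and $k\in\mathcal K$ let $\mathfrak X^n\subset\mathbb R^d$ be a nonempty countable set without accumulation points in $\mathbb R^d$, and $R^n_k=[r^n_k(x,y)]$ an irreducible stochastic rate matrix on $\mathfrak X^n$, with the convention $r^n_k(x,y)=0$ unless $x,y\in\mathfrak X^n$. Put $\mathcal Z^n_k(x)=\{z: r^n_k(x,x+z)>0\}$ and $\mathcal Z^n=\bigcup_{x\in\mathfrak X^n,\,k\in\mathcal K}\mathcal Z^n_k(x)$. Assume that there are points $x^n_*\in\mathbb R^d$ and positive constants $m_0,N_0,C_0$ such that for all $n\in\mathbb N$, $k\in\mathcal K$, $x,x'\in\mathfrak X^n$: (a) $r^n_k(x,x+z)=0$ whenever $|z|>m_0$; (b) $\mathcal Z^n_k(x)$ has at most $N_0$ elements; (c) $|r^n_k(x,x+z)-r^n_k(x',x'+z)|\le C_0(n^{\alpha/2}+|x-x'|)$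 for all $z\neq0$; (d) $r^n_k(x,x+z)\le C_0(n^{\alpha/2}+|x-x^n_*|+n)$ for all $z\ne0$. (These conditions imply that all the chains below are nonexplosive.) Let $(X^n,J^n)$ be the Markov chain on $\mathfrak X^n\times\mathcal K$ with rate matrix $$s^n((x,i),(y,j))=r^n_i(x,y)\mathbf 1_{\{i=j\}}+n^\alpha q_{ij}\mathbf 1_{\{x=y\}},$$ let $\widehat X^n=n^{-\beta}(X^n-x^n_*)$, and let $\widehat{\mathfrak X}^n=\{n^{-\beta}(x-x^n_*):x\in\mathfrak X^n\}$ be its state space. The generator of $(\widehat X^n,J^n)$ is $$\widehat{\mathcal L}^nf(\hat x,k)=\sum_{z\in\mathcal Z^n_k(x)}r^n_k(x,x+z)\bigl(f(\hat x+n^{-\beta}z,k)-f(\hat x,k)\bigr)+\sum_{\ell\in\mathcal K}n^\alpha q_{k\ell}\bigl(f(\hat x,\ell)-f(\hat x,k)\bigr),\qquad x=n^\beta\hat x+x^n_*,$$ and the averaged generator is $$\overline{\mathcal L}^nf(\hat x)=\sum_{z\in\mathcal Z^n}\Bigl(\sum_{k\in\mathcal K}\pi_kr^n_k(x,x+z)\Bigr)\bigl(f(\hat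 x+n^{-\beta}z)-f(\hat x)\bigr),\qquad x=n^\beta\hat x+x^n_*.$$ **Theorem.** Suppose that there are nonnegative functions $\mathcal V^n\in C(\mathbb R^d)$, $n\in\mathbb N$, with $\mathcal V^n(x)\to\infty$ as $|x|\to\infty$ for each $n$, a number $n_0\in\mathbb N$ and positive constants $\varepsilon_0,C,\overline C_1,\overline C_2$, not depending on $n$, such that $$(1+|x|)\,|\mathcal V^n(x+y)-\mathcal V^n(x)|\le C|y|(1+\mathcal V^n(x)),$$ $$(1+|x|^2)\,|\mathcal V^n(x+y+z)-\mathcal V^n(x+y)-\mathcal V^n(x+z)+\mathcal V^n(x)|\le C|y||z|(1+\mathcal V^n(x))$$ for all $x\in\mathbb R^d$, $0<|y|,|z|<\varepsilon_0$, $n\in\mathbb N$, and $$\overline{\mathcal L}^n\mathcal V^n(\hat x)\le\overline C_1-\overline C_2\mathcal V^n(\hat x)\qquad\forall\,\hat x\in\widehat{\mathfrak X}^n,\ \forall\,n>n_0.$$ If $\alpha\le1$, suppose also that $\sup_{n}\mathcal V^n(0)<\infty$. Then there exist functions $\widehat{\mathcal V}^n\in C(\mathbb R^d\times\mathcal K)$,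 positive constants $\widehat C_1,\widehat C_2$ not depending on $n$, and $n_1\in\mathbb N$ such that $$\tfrac12(\mathcal V^n(\hat x)-1)\le\widehat{\mathcal V}^n(\hat x,k)\le\tfrac32\mathcal V^n(\hat x)+\tfrac12\qquad\forall(\hat x,k)\in\widehat{\mathfrak X}^n\times\mathcal K,\ \forall\,n\ge n_1,$$ $$\widehat{\mathcal L}^n\widehat{\mathcal V}^n(\hat x,k)\le\widehat C_1-\widehat C_2\widehat{\mathcal V}^n(\hat x,k)\qquad\forall(\hat x,k)\in\widehat{\mathfrak X}^n\times\mathcal K,\ \forall\,n>n_1.$$ Moreover, for every $n>n_1$ the chain $(\widehat X^n,J^n)$ is exponentially ergodic: it has an invariant probability distribution $\mu^n$, and there are $\kappa>0$ and a finite function $B$ on the state space (both may depend on $n$) with $\|P^n_t(p,\cdot)-\mu^n\|_{TV}\le B(p)e^{-\kappa t}$ for all states $p$ and all $t\ge0$, where $P^n_t$ is the transition function. If in addition $\inf_n\mathcal V^n(x)\to\infty$ as $|x|\to\infty$ (as is the case, for example, when $\mathcal V^n$ does not depend on $n$), then the invariant probability distributions of $(\widehat X^n,J^n)$, $n>n_1$,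 form a tight family on $\mathbb R^d\times\mathcal K$. -/

import Mathlib

open Filter Topology MeasureTheory Set
open scoped ENNReal

/-! ### Continuous-time Markov chains on a countable set, given by a rate matrix -/

/-- A (conservative, stable) stochastic rate matrix: nonnegative off-diagonal entries and
zero row sums, so that `q x x = -∑_{y ≠ x} q x y` is finite. -/
structure IsRateMatrix {S : Type*} (q : S → S → ℝ) : Prop where
  offdiag_nonneg : ∀ x y, x ≠ y → 0 ≤ q x y
  row_sum : ∀ x, HasSum (q x) 0

/-- Irreducibility: every state leads to every other state through positive rates. -/
def IsIrreducibleRate {S : Type*} (q : S → S → ℝ) : Prop :=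
  ∀ x y, Relation.ReflTransGen (fun a b => 0 < q a b) x y

open Classical in
/-- `jumpTransition q m t x y` is the probability that the chain with rate matrix `q`, started
at `x`, is at `y` at time `t` after exactly `m` jumps: hold at `x` for an exponential time of
parameter `-q x x`, then jump to `z ≠ x` at rate `q x z`. -/
noncomputable def jumpTransition {S : Type*} (q : S → S → ℝ) : ℕ → ℝ → S → S → ℝ≥0∞
  | 0, t, x, y => if x = y then ENNReal.ofReal (Real.exp (q x x * t)) else 0
  | m + 1, t, x, y =>
      ∫⁻ s in Set.Icc 0 t, ENNReal.ofReal (Real.exp (q x x * s)) *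
        ∑' z, (if z = x then 0 else ENNReal.ofReal (q x z)) * jumpTransition q m (t - s) z y

/-- The (minimal) transition function `P_t(x, y)`, `t ≥ 0`, of the chain with rate matrix `q`;
it is the transition function of the chain when the chain is nonexplosive. -/
noncomputable def transition {S : Type*} (q : S → S → ℝ) (t : ℝ) (x y : S) : ℝ≥0∞ :=
  ∑' m, jumpTransition q m t x y

/-- `μ` is an invariant probability distribution of the chain with rate matrix `q`. -/
def IsInvariantLaw {S : Type*} (q : S → S → ℝ) (μ : PMF S) : Prop :=
  ∀ t, 0 ≤ t → ∀ y, ∑' x, μ x * transition q t x y = μ y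

/-- The total variation distance `∑_y |P_t(x, y) - μ(y)|`. -/
noncomputable def tvDist {S : Type*} (q : S → S → ℝ) (t : ℝ) (x : S) (μ : PMF S) : ℝ≥0∞ :=
  ∑' y, ENNReal.ofReal |(transition q t x y).toReal - (μ y).toReal|

/-- Exponential ergodicity: there is an invariant probability distribution to which the
transition probabilities converge in total variation, exponentially fast in time, at a rate that
does not depend on the initial state. -/
def IsExponentiallyErgodic {S : Type*} (q : S → S → ℝ) : Prop :=
  ∃ μ : PMF S, IsInvariantLaw q μ ∧ ∃ (κ : ℝ) (B : S → ℝ), 0 < κ ∧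
    ∀ t, 0 ≤ t → ∀ x, tvDist q t x μ ≤ ENNReal.ofReal (B x * Real.exp (-κ * t))

/-! ### The Markov-modulated model -/

/-- The data of the model.  Only the indices `n ≥ 1` matter.  The matrix `R^n_k` lives on the
set `X n`; as a function on all of `ℝ^d × ℝ^d` its entries are zero outside `X n × X n`. -/
structure ModulatedModel (d k₀ : ℕ) where
  α : ℝ
  α_pos : 0 < α
  /-- rate matrix of the modulating chain -/
  Q : Fin k₀ → Fin k₀ → ℝ
  Q_rate : IsRateMatrix Q
  Q_irred : IsIrreducibleRate Q
  /-- invariant probability distribution of `Q` -/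
  π : Fin k₀ → ℝ
  π_nonneg : ∀ k, 0 ≤ π k
  π_sum : ∑ k, π k = 1
  π_inv : ∀ l, ∑ k, π k * Q k l = 0
  X : ℕ → Set (EuclideanSpace ℝ (Fin d))
  X_nonempty : ∀ n, 1 ≤ n → (X n).Nonempty
  X_countable : ∀ n, 1 ≤ n → (X n).Countable
  X_no_acc : ∀ n, 1 ≤ n → ∀ x, ¬ AccPt x (𝓟 (X n))
  r : ℕ → Fin k₀ → EuclideanSpace ℝ (Fin d) → EuclideanSpace ℝ (Fin d) → ℝ
  r_zero : ∀ n, 1 ≤ n → ∀ k x y, ¬ (x ∈ X n ∧ y ∈ X n) → r n k x y = 0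
  r_rate : ∀ n, 1 ≤ n → ∀ k, IsRateMatrix (fun x y : X n => r n k x y)
  r_irred : ∀ n, 1 ≤ n → ∀ k, IsIrreducibleRate (fun x y : X n => r n k x y)

namespace ModulatedModel

variable {d k₀ : ℕ} (M : ModulatedModel d k₀)

/-- The jump set `Z^n_k(x)`. -/
def jumps (n : ℕ) (k : Fin k₀) (x : EuclideanSpace ℝ (Fin d)) :
    Set (EuclideanSpace ℝ (Fin d)) :=
  {z | 0 < M.r n k x (x + z)}

/-- The set `Z^n` of all jumps. -/
def allJumps (n : ℕ) : Set (EuclideanSpace ℝ (Fin d)) :=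
  ⋃ x ∈ M.X n, ⋃ k, M.jumps n k x

/-- The structural hypotheses on the rates, with reference points `xs n = x^n_*`. -/
structure Structural (xs : ℕ → EuclideanSpace ℝ (Fin d)) (m₀ : ℝ) (N₀ : ℕ) (C₀ : ℝ) :
    Prop where
  bounded_jumps : ∀ n, 1 ≤ n → ∀ k, ∀ x ∈ M.X n, ∀ z, m₀ < ‖z‖ → M.r n k x (x + z) = 0
  finite_jumps : ∀ n, 1 ≤ n → ∀ k, ∀ x ∈ M.X n, (M.jumps n k x).encard ≤ N₀
  incr_growth : ∀ n, 1 ≤ n → ∀ k, ∀ x ∈ M.X n, ∀ x' ∈ M.X n, ∀ z, z ≠ 0 →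
    |M.r n k x (x + z) - M.r n k x' (x' + z)| ≤ C₀ * ((n : ℝ) ^ (M.α / 2) + ‖x - x'‖)
  affine_growth : ∀ n, 1 ≤ n → ∀ k, ∀ x ∈ M.X n, ∀ z, z ≠ 0 →
    M.r n k x (x + z) ≤ C₀ * ((n : ℝ) ^ (M.α / 2) + ‖x - xs n‖ + n)

/-- The exponent `β = max {1/2, 1 - α/2}`. -/
noncomputable def β : ℝ := max (1 / 2) (1 - M.α / 2)

/-- The scaling map `x ↦ n^{-β} (x - x^n_*)`. -/
noncomputable def scale (xs : ℕ → EuclideanSpace ℝ (Fin d)) (n : ℕ)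
    (x : EuclideanSpace ℝ (Fin d)) : EuclideanSpace ℝ (Fin d) :=
  (n : ℝ) ^ (-M.β) • (x - xs n)

/-- The inverse map `x̂ ↦ n^β x̂ + x^n_*`. -/
noncomputable def unscale (xs : ℕ → EuclideanSpace ℝ (Fin d)) (n : ℕ)
    (x : EuclideanSpace ℝ (Fin d)) : EuclideanSpace ℝ (Fin d) :=
  (n : ℝ) ^ M.β • x + xs n

/-- The state space of the scaled process. -/
def hatX (xs : ℕ → EuclideanSpace ℝ (Fin d)) (n : ℕ) : Set (EuclideanSpace ℝ (Fin d)) :=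
  M.scale xs n '' M.X n

/-- The averaged rates `r̄^n(x, z) = ∑_k π_k r^n_k(x, x + z)`. -/
noncomputable def avgRate (n : ℕ) (x z : EuclideanSpace ℝ (Fin d)) : ℝ :=
  ∑ k, M.π k * M.r n k x (x + z)

/-- The generator of the averaged process, on functions of the space variable. -/
noncomputable def avgGen (xs : ℕ → EuclideanSpace ℝ (Fin d)) (n : ℕ)
    (f : EuclideanSpace ℝ (Fin d) → ℝ) (x : EuclideanSpace ℝ (Fin d)) : ℝ :=
  ∑ᶠ z ∈ M.allJumps n,
    M.avgRate n (M.unscale xs n x) z * (f (x + (n : ℝ) ^ (-M.β) • z) - f x)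

/-- The generator of the scaled joint process: the space part in regime `k` plus the
regime-switching part. -/
noncomputable def jointGen (xs : ℕ → EuclideanSpace ℝ (Fin d)) (n : ℕ)
    (f : EuclideanSpace ℝ (Fin d) × Fin k₀ → ℝ) (x : EuclideanSpace ℝ (Fin d))
    (k : Fin k₀) : ℝ :=
  (∑ᶠ z ∈ M.jumps n k (M.unscale xs n x),
    M.r n k (M.unscale xs n x) (M.unscale xs n x + z) *
      (f (x + (n : ℝ) ^ (-M.β) • z, k) - f (x, k))) +
  ∑ l, (n : ℝ) ^ M.α * M.Q k l * (f (x, l) - f (x, k))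

open Classical in
/-- The rate matrix of the scaled joint chain on its state space. -/
noncomputable def jointRate (xs : ℕ → EuclideanSpace ℝ (Fin d)) (n : ℕ)
    (p q : M.hatX xs n × Fin k₀) : ℝ :=
  (if p.2 = q.2 then M.r n p.2 (M.unscale xs n p.1) (M.unscale xs n q.1) else 0) +
  (if p.1 = q.1 then (n : ℝ) ^ M.α * M.Q p.2 q.2 else 0)

/-- The invariant probability distributions of the `n`-th scaled joint chain, as measures on
`ℝ^d × {1, …, k₀}`. -/
def invariantMeasures (xs : ℕ → EuclideanSpace ℝ (Fin d)) (n : ℕ) :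
    Set (Measure (EuclideanSpace ℝ (Fin d) × Fin k₀)) :=
  {ν | ∃ μ : PMF (M.hatX xs n × Fin k₀), IsInvariantLaw (M.jointRate xs n) μ ∧
    ν = (μ.map fun p => ((p.1 : EuclideanSpace ℝ (Fin d)), p.2)).toMeasure}

end ModulatedModel

/-! The Lyapunov function of the averaged process is corrected so that it also serves the modulated
one. Irreducibility of `Q` makes the Poisson equation `Q T = 1 π - I` solvable (`exists_poisson`).
With `L_l` the space part of the generator in regime `l` (`spaceGen`), put `W(x, k) = V(x) + n^(-α)
∑ l, T k l * L_l V(x)`. The switching part of the generator, of speed `n^α`, turns the correction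
into the averaged generator applied to `V` minus `L_k V`, and the second term cancels the space part
acting on `V`. What remains is the averaged drift plus `L_k` applied to the correction
(`jointGen_corrector`).

That remainder is an iterated difference. By a discrete product rule it involves second differences
of `V`, and first differences of `V` times increments of the rates. The hypotheses bound it by a
constant times `ratio n x * (1 + V n x)` (`abs_averaging_error_le`), where `ratio n x ≤ n^(-β) +
n^(-α/2) + n^(1-β-α/2) / (1 + ‖x‖)`. The choice of `β` makes the last exponent nonpositive. If `α >
1` it is negative and the ratio tends to zero uniformly. If `α ≤ 1` it is zero; the last term is
then small only for large `‖x‖`, and on balls `V` is bounded uniformly in `n` through its value at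
the origin. In both cases the error is at most `δ (1 + V) + B` for large `n`
(`exists_ratio_mul_le`), so half of the averaged drift survives. The correction itself carries a
further factor `n^(-α/2)`, whence the two-sided comparison of `W` with `V`. The rates vanish off the
state space, so `W` need not be continuous on the whole space; only its values on the scaled state
space matter, and as this set is closed and discrete they extend continuously.

Ergodicity is derived directly from the minimal transition function, a sum over numbers of jumps.
Supersolutions of the backward equation dominate the semigroup (`semigroup_le_of_supersolution`).
This gives the moment bound `P_t U ≤ e^(-ct) U + D/c` and, with finiteness of the sublevel sets,
nonexplosion. Irreducibility makes all transition probabilities positive, so finite sublevel sets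
are minorized by a point mass, and Harris' theorem in its weighted Lipschitz form gives a geometric
contraction (`harris_contraction`). Tightness follows from a Markov inequality valid for every
invariant law, with constants independent of `n` (`invariantLaw_tail_le`). -/

/-! ### The minimal transition function, decomposed by the number of jumps. -/

section Chain

variable {S : Type*} (q : S → S → ℝ)

open Classical in
/-- The off-diagonal part of a rate matrix. -/
noncomputable def jumpRate (x z : S) : ℝ≥0∞ := if z = x then 0 else ENNReal.ofReal (q x z)

/-- The expectation of `f` at time `t`, on the event that exactly `m` jumps have occurred. -/
noncomputable def jumpExp (m : ℕ) (f : S → ℝ≥0∞) (t : ℝ) (x : S) : ℝ≥0∞ :=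
  ∑' y, jumpTransition q m t x y * f y

lemma jumpTransition_succ (m : ℕ) (t : ℝ) (x y : S) :
    jumpTransition q (m + 1) t x y = ∫⁻ s in Icc 0 t, ENNReal.ofReal (Real.exp (q x x * s)) *
        ∑' z, jumpRate q x z * jumpTransition q m (t - s) z y := rfl

lemma jumpTransition_zero_self (t : ℝ) (x : S) :
    jumpTransition q 0 t x x = ENNReal.ofReal (Real.exp (q x x * t)) := by
  simp [jumpTransition]

lemma jumpTransition_zero_of_ne (t : ℝ) {x y : S} (h : x ≠ y) :
    jumpTransition q 0 t x y = 0 := by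
  simp [jumpTransition, h]

lemma jumpExp_zero (f : S → ℝ≥0∞) (t : ℝ) (x : S) :
    jumpExp q 0 f t x = ENNReal.ofReal (Real.exp (q x x * t)) * f x := by
  rw [jumpExp, tsum_eq_single x, jumpTransition_zero_self]
  intro y hy
  rw [jumpTransition_zero_of_ne q t hy.symm, zero_mul]

lemma measurable_setLIntegral_Icc {F : ℝ × ℝ → ℝ≥0∞} (hF : Measurable F) :
    Measurable fun t : ℝ => ∫⁻ s in Icc 0 t, F (t, s) := by
  have hs : MeasurableSet {p : ℝ × ℝ | 0 ≤ p.2 ∧ p.2 ≤ p.1} :=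
    (measurableSet_le measurable_const measurable_snd).inter
      (measurableSet_le measurable_snd measurable_fst)
  have h := (hF.indicator hs).lintegral_prod_right' (ν := volume)
  convert h using 2 with t
  rw [← lintegral_indicator measurableSet_Icc]
  rfl

lemma measurable_exp_rate (x : S) :
    Measurable fun s : ℝ => ENNReal.ofReal (Real.exp (q x x * s)) := by fun_prop

lemma measurable_tsum_jumpRate [Countable S] {G : ℝ → S → ℝ≥0∞}
    (hG : ∀ z, Measurable fun t => G t z) (x : S) :
    Measurable fun p : ℝ × ℝ => ENNReal.ofReal (Real.exp (q x x * p.2)) *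
        ∑' z, jumpRate q x z * G (p.1 - p.2) z := by
  refine ((measurable_exp_rate q x).comp measurable_snd).mul ?_
  refine Measurable.tsum fun z => measurable_const.mul ?_
  exact (hG z).comp (measurable_fst.sub measurable_snd)

lemma measurable_tsum_jumpRate_right [Countable S] {G : ℝ → S → ℝ≥0∞}
    (hG : ∀ z, Measurable fun t => G t z) (x : S) (t : ℝ) :
    Measurable fun s : ℝ => ENNReal.ofReal (Real.exp (q x x * s)) *
        ∑' z, jumpRate q x z * G (t - s) z :=
  (measurable_tsum_jumpRate q hG x).comp measurable_prodMk_left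

lemma measurable_jumpTransition [Countable S] (m : ℕ) (x y : S) :
    Measurable fun t => jumpTransition q m t x y := by
  induction m generalizing x with
  | zero =>
    by_cases h : x = y
    · subst h
      simp only [jumpTransition_zero_self]
      exact measurable_exp_rate q x
    · simp only [jumpTransition_zero_of_ne q _ h]
      exact measurable_const
  | succ m ih =>
    simp only [jumpTransition_succ]
    exact measurable_setLIntegral_Icc (measurable_tsum_jumpRate q (G := fun t z =>
      jumpTransition q m t z y) ih x)

lemma measurable_jumpExp [Countable S] (m : ℕ) (f : S → ℝ≥0∞) (x : S) :
    Measurable fun t => jumpExp q m f t x :=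
  Measurable.tsum fun y => (measurable_jumpTransition q m x y).mul_const _

/-- Decomposition at the first jump; Tonelli moves the sum over final states inside the time
integral. -/
lemma jumpExp_succ [Countable S] (m : ℕ) (f : S → ℝ≥0∞) (t : ℝ) (x : S) :
    jumpExp q (m + 1) f t x = ∫⁻ s in Icc 0 t, ENNReal.ofReal (Real.exp (q x x * s)) *
        ∑' z, jumpRate q x z * jumpExp q m f (t - s) z := by
  have hm : ∀ y, Measurable fun s : ℝ => ENNReal.ofReal (Real.exp (q x x * s)) *
        ∑' z, jumpRate q x z * jumpTransition q m (t - s) z y := fun y =>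
    measurable_tsum_jumpRate_right q (G := fun t z => jumpTransition q m t z y)
      (fun z => measurable_jumpTransition q m z y) x t
  calc jumpExp q (m + 1) f t x
      = ∑' y, ∫⁻ s in Icc 0 t, (ENNReal.ofReal (Real.exp (q x x * s)) *
        ∑' z, jumpRate q x z * jumpTransition q m (t - s) z y) * f y := by
        simp only [jumpExp, jumpTransition_succ]
        exact tsum_congr fun y => (lintegral_mul_const _ (hm y)).symm
    _ = ∫⁻ s in Icc 0 t, ∑' y, (ENNReal.ofReal (Real.exp (q x x * s)) *
        ∑' z, jumpRate q x z * jumpTransition q m (t - s) z y) * f y :=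
        (lintegral_tsum fun y => ((hm y).mul_const _).aemeasurable).symm
    _ = _ := by
        refine lintegral_congr fun s => ?_
        simp only [jumpExp, mul_assoc, ENNReal.tsum_mul_left]
        congr 1
        simp only [← ENNReal.tsum_mul_right, ← ENNReal.tsum_mul_left]
        rw [ENNReal.tsum_comm]
        simp only [mul_assoc]

lemma jumpExp_single (m : ℕ) (t : ℝ) (x y : S) [DecidableEq S] :
    jumpExp q m (Pi.single y 1) t x = jumpTransition q m t x y := by
  rw [jumpExp, tsum_eq_single y]
  · simp
  · intro z hz
    simp [hz]

/-- The Chapman–Kolmogorov equation, refined by the number of jumps. -/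
lemma jumpExp_add [Countable S] (m : ℕ) (f : S → ℝ≥0∞) {t s : ℝ} (ht : 0 ≤ t) (hs : 0 ≤ s)
    (x : S) : jumpExp q m f (t + s) x =
      ∑ p ∈ Finset.HasAntidiagonal.antidiagonal m, jumpExp q p.1 (jumpExp q p.2 f s) t x := by
  induction m generalizing t x with
  | zero =>
    simp only [Finset.HasAntidiagonal.antidiagonal_zero, Finset.sum_singleton, jumpExp_zero]
    rw [mul_add, Real.exp_add, ENNReal.ofReal_mul (Real.exp_nonneg _), mul_assoc]
  | succ m ih =>
    have hG : ∀ r : ℝ, Measurable fun u : ℝ => ENNReal.ofReal (Real.exp (q x x * u)) *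
        ∑' z, jumpRate q x z * jumpExp q m f (r - u) z := fun r =>
      measurable_tsum_jumpRate_right q (G := fun t z => jumpExp q m f t z)
        (measurable_jumpExp q m f) x r
    -- The first jump occurs after time `t`, which is the term with no jump in `[0, t]`, or before
    -- it, where the induction hypothesis applies to the remaining time.
    rw [Finset.Nat.sum_antidiagonal_succ, jumpExp_succ, ← Icc_union_Ioc_eq_Icc ht
      (show t ≤ t + s by linarith), lintegral_union measurableSet_Ioc
      (Set.disjoint_left.2 fun u hu hu' => not_lt.2 hu.2 hu'.1), add_comm]
    congr 1
    · rw [jumpExp_zero, jumpExp_succ, setLIntegral_congr Ioc_ae_eq_Icc,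
        ← lintegral_indicator measurableSet_Icc, ← lintegral_indicator measurableSet_Icc,
        ← lintegral_add_right_eq_self _ t, ← lintegral_const_mul]
      · refine lintegral_congr fun u => ?_
        by_cases hu : u ∈ Icc 0 s
        · have hu' : u + t ∈ Icc t (t + s) := ⟨by linarith [hu.1], by linarith [hu.2]⟩
          rw [indicator_of_mem hu, indicator_of_mem hu', mul_add, add_comm (q x x * u),
            Real.exp_add, ENNReal.ofReal_mul (Real.exp_nonneg _), mul_assoc]
          simp only [show t + s - (u + t) = s - u by ring]
        · have hu' : u + t ∉ Icc t (t + s) := fun h => hu ⟨by linarith [h.1], by linarith [h.2]⟩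
          rw [indicator_of_notMem hu, indicator_of_notMem hu', mul_zero]
      · exact (hG s).indicator measurableSet_Icc
    · simp only [jumpExp_succ]
      rw [← lintegral_finsetSum]
      · refine setLIntegral_congr_fun measurableSet_Icc fun u hu => ?_
        rw [← Finset.mul_sum, ← Summable.tsum_finsetSum fun _ _ => ENNReal.summable]
        congr 1
        refine tsum_congr fun z => ?_
        rw [← Finset.mul_sum, ← ih (by linarith [hu.2]), show t + s - u = t - u + s by ring]
      · intro p _
        exact measurable_tsum_jumpRate_right q (G := fun t z => jumpExp q p.1 _ t z)
          (measurable_jumpExp q p.1 _) x t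

/-- The transition semigroup acting on nonnegative functions. -/
noncomputable def semigroup (t : ℝ) (f : S → ℝ≥0∞) (x : S) : ℝ≥0∞ :=
  ∑' y, transition q t x y * f y

lemma semigroup_eq_tsum (t : ℝ) (f : S → ℝ≥0∞) (x : S) :
    semigroup q t f x = ∑' m, jumpExp q m f t x := by
  simp only [semigroup, transition, jumpExp, ← ENNReal.tsum_mul_right]
  exact ENNReal.tsum_comm

lemma ENNReal.tsum_sum_antidiagonal (f : ℕ × ℕ → ℝ≥0∞) :
    ∑' m, ∑ p ∈ Finset.HasAntidiagonal.antidiagonal m, f p = ∑' i, ∑' j, f (i, j) := by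
  rw [← ENNReal.tsum_prod (f := fun i j => f (i, j)),
    ← Finset.HasAntidiagonal.sigmaAntidiagonalEquivProd.tsum_eq,
    ENNReal.tsum_sigma']
  refine tsum_congr fun m => ?_
  rw [← Finset.tsum_subtype]
  rfl

lemma jumpExp_tsum (m : ℕ) (f : ℕ → S → ℝ≥0∞) (t : ℝ) (x : S) :
    jumpExp q m (fun y => ∑' j, f j y) t x = ∑' j, jumpExp q m (f j) t x := by
  simp only [jumpExp, ← ENNReal.tsum_mul_left]
  exact ENNReal.tsum_comm

lemma semigroup_add [Countable S] {t s : ℝ} (ht : 0 ≤ t) (hs : 0 ≤ s) (f : S → ℝ≥0∞) (x : S) :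
    semigroup q (t + s) f x = semigroup q t (semigroup q s f) x := by
  have h : semigroup q s f = fun y => ∑' j, jumpExp q j f s y :=
    funext fun y => semigroup_eq_tsum q s f y
  rw [semigroup_eq_tsum, semigroup_eq_tsum, h]
  simp only [jumpExp_tsum, jumpExp_add q _ f ht hs]
  exact ENNReal.tsum_sum_antidiagonal fun p => jumpExp q p.1 (jumpExp q p.2 f s) t x

lemma semigroup_single [DecidableEq S] (t : ℝ) (x y : S) :
    semigroup q t (Pi.single y 1) x = transition q t x y := by
  rw [semigroup_eq_tsum]
  simp only [jumpExp_single]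
  rfl

/-- The Chapman–Kolmogorov equation. -/
lemma transition_add [Countable S] {t s : ℝ} (ht : 0 ≤ t) (hs : 0 ≤ s) (x y : S) :
    transition q (t + s) x y = ∑' z, transition q t x z * transition q s z y := by
  classical
  rw [← semigroup_single, semigroup_add q ht hs, semigroup]
  simp only [semigroup_single]

/-- The expectation of `f` at time `t`, on the event that fewer than `m` jumps have occurred. -/
noncomputable def partialExp (m : ℕ) (f : S → ℝ≥0∞) (t : ℝ) (x : S) : ℝ≥0∞ :=
  ∑ i ∈ Finset.range m, jumpExp q i f t x

lemma semigroup_eq_iSup (t : ℝ) (f : S → ℝ≥0∞) (x : S) :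
    semigroup q t f x = ⨆ m, partialExp q m f t x := by
  rw [semigroup_eq_tsum, ENNReal.tsum_eq_iSup_nat]
  rfl

lemma measurable_partialExp [Countable S] (m : ℕ) (f : S → ℝ≥0∞) (x : S) :
    Measurable fun t => partialExp q m f t x :=
  Finset.measurable_sum _ fun i _ => measurable_jumpExp q i f x

lemma partialExp_zero (f : S → ℝ≥0∞) (t : ℝ) (x : S) : partialExp q 0 f t x = 0 := by
  simp [partialExp]

/-- Truncations by the number of jumps are the Picard iterates of the backward integral equation, so
bounds on the semigroup can be proved by induction on `m`. -/
lemma partialExp_succ [Countable S] (m : ℕ) (f : S → ℝ≥0∞) (t : ℝ) (x : S) :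
    partialExp q (m + 1) f t x = ENNReal.ofReal (Real.exp (q x x * t)) * f x +
      ∫⁻ s in Icc 0 t, ENNReal.ofReal (Real.exp (q x x * s)) *
        ∑' z, jumpRate q x z * partialExp q m f (t - s) z := by
  rw [partialExp, Finset.sum_range_succ', jumpExp_zero, add_comm]
  congr 1
  simp only [jumpExp_succ, partialExp]
  rw [← lintegral_finsetSum]
  · refine lintegral_congr fun s => ?_
    rw [← Finset.mul_sum, ← Summable.tsum_finsetSum fun _ _ => ENNReal.summable]
    simp only [Finset.mul_sum]
  · intro i _
    exact measurable_tsum_jumpRate_right q (G := fun t z => jumpExp q i f t z)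
      (measurable_jumpExp q i f) x t

end Chain

/-! ### Foster–Lyapunov drift: moment bounds, nonexplosion, positivity. -/

section Drift

variable {S : Type*} {q : S → S → ℝ}

lemma IsRateMatrix.diag_nonpos (hq : IsRateMatrix q) (x : S) : q x x ≤ 0 := by
  classical
  have h := (hq.row_sum x).update x 0
  have h0 : 0 ≤ 0 - q x x + 0 := by
    have h' : HasSum (Function.update (q x) x 0) (0 - q x x + 0) := h
    refine h'.nonneg fun y => ?_
    by_cases hy : y = x
    · simp [hy]
    · simpa [hy] using hq.offdiag_nonneg x y (Ne.symm hy)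
  linarith

lemma IsRateMatrix.tsum_jumpRate (hq : IsRateMatrix q) (x : S) :
    ∑' z, jumpRate q x z = ENNReal.ofReal (-q x x) := by
  classical
  have h := (hq.row_sum x).update x 0
  have h' : HasSum (Function.update (q x) x 0) (-q x x) := by
    rw [show -q x x = 0 - q x x + 0 by ring]
    exact h
  rw [← h'.tsum_eq, ENNReal.ofReal_tsum_of_nonneg _ h'.summable]
  · refine tsum_congr fun z => ?_
    by_cases hz : z = x
    · simp [jumpRate, hz]
    · simp [jumpRate, hz]
  · intro y
    by_cases hy : y = x
    · simp [hy]
    · simpa [hy] using hq.offdiag_nonneg x y (Ne.symm hy)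

lemma setLIntegral_ofReal_deriv {F F' : ℝ → ℝ} (hF : ∀ s, HasDerivAt F (F' s) s)
    (hF' : Continuous F') {t : ℝ} (ht : 0 ≤ t) (hnn : ∀ s ∈ Icc 0 t, 0 ≤ F' s) :
    ∫⁻ s in Icc 0 t, ENNReal.ofReal (F' s) = ENNReal.ofReal (F t - F 0) := by
  rw [← intervalIntegral.integral_eq_sub_of_hasDerivAt (fun s _ => hF s)
    (hF'.intervalIntegrable 0 t), intervalIntegral.integral_of_le ht, ← integral_Icc_eq_integral_Ioc,
    ofReal_integral_eq_lintegral_ofReal hF'.continuousOn.integrableOn_Icc]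
  exact (ae_restrict_iff' measurableSet_Icc).2 (Eventually.of_forall hnn)

/-- Variation of constants: the integrand is the derivative in `s` of `-exp (a s) φ (t - s)`. The
sign condition keeps the identity meaningful in `ℝ≥0∞`. -/
lemma backward_eq {φ φ' : ℝ → ℝ} (a : ℝ) (hφ : ∀ s, HasDerivAt φ (φ' s) s)
    (hφ' : Continuous φ') {t : ℝ} (ht : 0 ≤ t) (h0 : 0 ≤ φ 0)
    (hnn : ∀ s, 0 ≤ s → 0 ≤ φ' s - a * φ s) :
    ENNReal.ofReal (Real.exp (a * t)) * ENNReal.ofReal (φ 0) +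
      ∫⁻ s in Icc 0 t, ENNReal.ofReal (Real.exp (a * s)) *
        ENNReal.ofReal (φ' (t - s) - a * φ (t - s)) = ENNReal.ofReal (φ t) := by
  have hcont : Continuous φ := continuous_iff_continuousAt.2 fun s => (hφ s).continuousAt
  have hnn' : ∀ s ∈ Icc 0 t, 0 ≤ Real.exp (a * s) * (φ' (t - s) - a * φ (t - s)) :=
    fun s hs => mul_nonneg (Real.exp_nonneg _) (hnn _ (by linarith [hs.2]))
  have hF : ∀ s, HasDerivAt (fun s => -(Real.exp (a * s) * φ (t - s)))
      (Real.exp (a * s) * (φ' (t - s) - a * φ (t - s))) s := by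
    intro s
    have h1 : HasDerivAt (fun s => Real.exp (a * s)) (Real.exp (a * s) * (a * 1)) s :=
      ((hasDerivAt_id s).const_mul a).exp
    have h2 : HasDerivAt (fun s => φ (t - s)) (φ' (t - s) * (0 - 1)) s :=
      (hφ (t - s)).comp s ((hasDerivAt_const s t).sub (hasDerivAt_id s))
    exact (h1.mul h2).neg.congr_deriv (by ring)
  have hc : Continuous fun s => Real.exp (a * s) * (φ' (t - s) - a * φ (t - s)) := by fun_prop
  have h := setLIntegral_ofReal_deriv hF hc ht hnn'
  have hle : 0 ≤ ∫ s in (0 : ℝ)..t, Real.exp (a * s) * (φ' (t - s) - a * φ (t - s)) :=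
    intervalIntegral.integral_nonneg ht hnn'
  rw [intervalIntegral.integral_eq_sub_of_hasDerivAt (fun s _ => hF s)
    (hc.intervalIntegrable 0 t)] at hle
  simp only [ENNReal.ofReal_mul (Real.exp_nonneg _)] at h
  rw [h, ← ENNReal.ofReal_mul (Real.exp_nonneg _), ← ENNReal.ofReal_add
    (mul_nonneg (Real.exp_nonneg _) h0) hle]
  congr 1
  simp

lemma backward_le {x : S} {φ φ' : ℝ → ℝ} (hφ : ∀ s, HasDerivAt φ (φ' s) s)
    (hφ' : Continuous φ') {t : ℝ} (ht : 0 ≤ t) (h0 : 0 ≤ φ 0)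
    (hnn : ∀ s, 0 ≤ s → 0 ≤ φ' s - q x x * φ s) {G : ℝ → S → ℝ≥0∞}
    (hG : ∀ s, 0 ≤ s → ∑' z, jumpRate q x z * G s z ≤ ENNReal.ofReal (φ' s - q x x * φ s)) :
    ENNReal.ofReal (Real.exp (q x x * t)) * ENNReal.ofReal (φ 0) +
      ∫⁻ s in Icc 0 t, ENNReal.ofReal (Real.exp (q x x * s)) *
        ∑' z, jumpRate q x z * G (t - s) z ≤ ENNReal.ofReal (φ t) := by
  rw [← backward_eq (q x x) hφ hφ' ht h0 hnn]
  refine add_le_add le_rfl (setLIntegral_mono' measurableSet_Icc fun s hs => ?_)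
  exact mul_le_mul_right (hG _ (by linarith [hs.2])) _

/-- A supersolution of the backward equation dominates the semigroup. -/
lemma semigroup_le_of_supersolution [Countable S] {ψ ψ' : S → ℝ → ℝ}
    (hψ : ∀ x s, HasDerivAt (ψ x) (ψ' x s) s) (hψ' : ∀ x, Continuous (ψ' x))
    (h0 : ∀ x, 0 ≤ ψ x 0) (hnn : ∀ x s, 0 ≤ s → 0 ≤ ψ' x s - q x x * ψ x s)
    (hsup : ∀ x s, 0 ≤ s → ∑' z, jumpRate q x z * ENNReal.ofReal (ψ z s) ≤
      ENNReal.ofReal (ψ' x s - q x x * ψ x s)) {t : ℝ} (ht : 0 ≤ t) (x : S) :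
    semigroup q t (fun y => ENNReal.ofReal (ψ y 0)) x ≤ ENNReal.ofReal (ψ x t) := by
  rw [semigroup_eq_iSup]
  refine iSup_le fun m => ?_
  -- Picard iteration starts at zero, below `ψ`, and the supersolution property propagates the bound
  -- from each iterate to the next.
  induction m generalizing t x with
  | zero => simp [partialExp_zero]
  | succ m ih =>
    rw [partialExp_succ]
    refine le_trans (add_le_add le_rfl ?_) (backward_le (q := q) (x := x) (hψ x) (hψ' x) ht (h0 x)
      (hnn x) (G := fun s z => ENNReal.ofReal (ψ z s)) (hsup x))
    refine setLIntegral_mono' measurableSet_Icc fun s hs => mul_le_mul_right ?_ _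
    exact ENNReal.tsum_le_tsum fun z => mul_le_mul_right (ih (by linarith [hs.2]) z) _

/-- A Foster–Lyapunov drift condition towards finite sublevel sets. -/
structure FosterLyapunov (q : S → S → ℝ) (U : S → ℝ) (c D : ℝ) : Prop where
  rate : IsRateMatrix q
  one_le : ∀ x, 1 ≤ U x
  finite_sublevel : ∀ R, {x | U x ≤ R}.Finite
  c_pos : 0 < c
  D_nonneg : 0 ≤ D
  drift_nonneg : ∀ x, 0 ≤ D - c * U x - q x x * U x
  drift : ∀ x, ∑' z, jumpRate q x z * ENNReal.ofReal (U z) ≤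
    ENNReal.ofReal (D - c * U x - q x x * U x)

lemma IsRateMatrix.semigroup_one_le [Countable S] (hq : IsRateMatrix q) {t : ℝ} (ht : 0 ≤ t)
    (x : S) : semigroup q t 1 x ≤ 1 := by
  have h := semigroup_le_of_supersolution (q := q) (ψ := fun _ _ => 1) (ψ' := fun _ _ => 0)
    (fun x s => hasDerivAt_const s 1) (fun x => continuous_const) (fun x => zero_le_one)
    (fun x s _ => by linarith [hq.diag_nonpos x])
    (fun x s _ => by simp [hq.tsum_jumpRate x]) ht x
  simp only [ENNReal.ofReal_one] at h
  exact h

namespace FosterLyapunov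

variable {U : S → ℝ} {c D : ℝ}

lemma U_nonneg (h : FosterLyapunov q U c D) (x : S) : 0 ≤ U x := zero_le_one.trans (h.one_le x)

lemma tsum_affine_le (h : FosterLyapunov q U c D) (x : S) {a b : ℝ} (ha : 0 ≤ a) (hb : 0 ≤ b) :
    ∑' z, jumpRate q x z * ENNReal.ofReal (a * U z + b) ≤
      ENNReal.ofReal (a * (D - c * U x - q x x * U x) + (-q x x) * b) := by
  have hq : 0 ≤ -q x x := by linarith [h.rate.diag_nonpos x]
  rw [ENNReal.ofReal_add (mul_nonneg ha (h.drift_nonneg x)) (mul_nonneg hq hb),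
    ENNReal.ofReal_mul ha, ENNReal.ofReal_mul hq, ← h.rate.tsum_jumpRate, ← ENNReal.tsum_mul_right]
  refine le_trans (le_of_eq ?_) (add_le_add (mul_le_mul_right (h.drift x) _) le_rfl)
  rw [← ENNReal.tsum_mul_left, ← ENNReal.tsum_add]
  refine tsum_congr fun z => ?_
  rw [ENNReal.ofReal_add (mul_nonneg ha (h.U_nonneg z)) hb, ENNReal.ofReal_mul ha]
  ring

/-- The function `e^(-cs) U + (D/c) (1 - e^(-cs))` solves `y' = D - c y` with initial value `U`, and
the drift condition makes it a supersolution. -/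
lemma semigroup_le [Countable S] (h : FosterLyapunov q U c D) {t : ℝ} (ht : 0 ≤ t) (x : S) :
    semigroup q t (fun y => ENNReal.ofReal (U y)) x ≤
      ENNReal.ofReal (Real.exp (-c * t) * U x + D / c) := by
  have hc := h.c_pos
  have hψ : ∀ x s, HasDerivAt (fun s => Real.exp (-c * s) * U x + D / c * (1 - Real.exp (-c * s)))
      (Real.exp (-c * s) * (D - c * U x)) s := by
    intro x s
    have h1 : HasDerivAt (fun s => Real.exp (-c * s)) (Real.exp (-c * s) * (-c * 1)) s :=
      ((hasDerivAt_id s).const_mul (-c)).exp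
    refine ((h1.mul_const (U x)).add ((h1.const_sub 1).const_mul (D / c))).congr_deriv ?_
    field_simp
    ring
  have hexp : ∀ s, 0 ≤ s → 0 ≤ D / c * (1 - Real.exp (-c * s)) := fun s hs =>
    mul_nonneg (div_nonneg h.D_nonneg hc.le)
      (sub_nonneg.2 (Real.exp_le_one_iff.2 (by nlinarith)))
  have key : ∀ x s, Real.exp (-c * s) * (D - c * U x) -
      q x x * (Real.exp (-c * s) * U x + D / c * (1 - Real.exp (-c * s))) =
      Real.exp (-c * s) * (D - c * U x - q x x * U x) +
        (-q x x) * (D / c * (1 - Real.exp (-c * s))) := fun x s => by ring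
  have hmain := semigroup_le_of_supersolution (q := q) hψ
    (fun x => by fun_prop) (fun x => by simpa using h.U_nonneg x)
    (fun x s hs => by
      rw [key]
      exact add_nonneg (mul_nonneg (Real.exp_nonneg _) (h.drift_nonneg x))
        (mul_nonneg (by linarith [h.rate.diag_nonpos x]) (hexp s hs)))
    (fun x s hs => by
      rw [key]
      exact h.tsum_affine_le x (Real.exp_nonneg _) (hexp s hs)) ht x
  simp only [mul_zero, Real.exp_zero, one_mul, sub_self, add_zero] at hmain
  refine hmain.trans (ENNReal.ofReal_le_ofReal (add_le_add le_rfl ?_))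
  refine mul_le_of_le_one_right (div_nonneg h.D_nonneg hc.le) ?_
  linarith [Real.exp_pos (-c * t)]

/-- Mass is missing from the truncated semigroup for two reasons. The chain may leave `{U ≤ R}`
before time `t`; this is paid for by `(U + D t) / R`, as `U` grows at mean rate at most `D`. Or it
may make `m` jumps while its exit rates are at most `L`; this is paid for by the Chernoff bound
`2^(-m) e^(Lt)`, since `e^(Lt)` is the mean of `2^N` for a Poisson variable `N` of mean `L t`. -/
lemma one_le_partialExp_add [Countable S] (h : FosterLyapunov q U c D) {R L : ℝ} (hR : 0 < R)
    (hL : 0 ≤ L) (hRL : ∀ x, U x ≤ R → -q x x ≤ L) (m : ℕ) {t : ℝ} (ht : 0 ≤ t) (x : S) :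
    1 ≤ partialExp q m 1 t x +
      ENNReal.ofReal ((U x + D * t) / R + (1 / 2) ^ m * Real.exp (L * t)) := by
  have hD := h.D_nonneg
  induction m generalizing t x with
  | zero =>
    rw [partialExp_zero, zero_add, ← ENNReal.ofReal_one]
    refine ENNReal.ofReal_le_ofReal ?_
    have h1 : 1 ≤ Real.exp (L * t) := Real.one_le_exp (by positivity)
    have h2 : 0 ≤ (U x + D * t) / R := by
      have := h.U_nonneg x
      positivity
    simp only [pow_zero, one_mul]
    linarith
  | succ m ih =>
    have hU := h.U_nonneg x
    by_cases hx : U x ≤ R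
    · have hq0 : 0 ≤ -q x x := by linarith [h.rate.diag_nonpos x]
      have h1 := backward_eq (φ := fun _ => 1) (φ' := fun _ => 0) (q x x)
        (fun s => hasDerivAt_const s 1) continuous_const ht zero_le_one
        (fun s _ => by linarith [h.rate.diag_nonpos x])
      simp only [mul_one, zero_sub, ENNReal.ofReal_one] at h1
      have h2 : ∀ s, HasDerivAt (fun t => (U x + D * t) / R + (1 / 2) ^ (m + 1) * Real.exp (L * t))
          (D / R + (1 / 2) ^ (m + 1) * (L * Real.exp (L * s))) s := by
        intro s
        have h3 : HasDerivAt (fun s => Real.exp (L * s)) (Real.exp (L * s) * (L * 1)) s :=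
          ((hasDerivAt_id s).const_mul L).exp
        have h4 : HasDerivAt (fun s => (U x + D * s) / R) (D * 1 / R) s :=
          (((hasDerivAt_id s).const_mul D).const_add (U x)).div_const R
        exact (h4.add (h3.const_mul _)).congr_deriv (by ring)
      have h3 := backward_le (q := q) (x := x) h2 (by fun_prop) ht (by positivity)
        (fun s hs => by
          have : 0 ≤ (-q x x) * ((U x + D * s) / R + (1 / 2) ^ (m + 1) * Real.exp (L * s)) := by
            positivity
          have h5 : 0 ≤ D / R + (1 / 2) ^ (m + 1) * (L * Real.exp (L * s)) := by positivity
          linarith)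
        (G := fun s z => ENNReal.ofReal ((U z + D * s) / R + (1 / 2) ^ m * Real.exp (L * s)))
        (fun s hs => by
          have h4 : ∀ z, (U z + D * s) / R + (1 / 2) ^ m * Real.exp (L * s) =
            1 / R * U z + (D * s / R + (1 / 2) ^ m * Real.exp (L * s)) := fun z => by ring
          simp only [h4]
          refine (h.tsum_affine_le x (by positivity) (by positivity)).trans
            (ENNReal.ofReal_le_ofReal ?_)
          -- A jump doubles the Chernoff term, which its growth rate `L` compensates because `-q x x
          -- ≤ L`.
          have h5 : (-q x x) * ((1 / 2) ^ m * Real.exp (L * s)) ≤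
              (L + (-q x x)) * ((1 / 2) ^ (m + 1) * Real.exp (L * s)) := by
            have h6 : 0 ≤ (1 / 2 : ℝ) ^ m * Real.exp (L * s) := by positivity
            rw [pow_succ]
            nlinarith [hRL x hx]
          have h7 : 0 ≤ 1 / R * (c * U x) := by
            have := h.c_pos
            positivity
          have h8 : D / R = 1 / R * D := by ring
          have h9 : D * s / R = 1 / R * (D * s) := by ring
          have h10 : 1 / R * U x + D * s / R = 1 / R * (U x + D * s) := by ring
          rw [h8, h9, show (U x + D * s) / R = 1 / R * (U x + D * s) by ring]
          nlinarith)
      have hm1 := measurable_tsum_jumpRate_right q (G := fun t z => partialExp q m 1 t z)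
        (measurable_partialExp q m 1) x t
      rw [partialExp_succ, Pi.one_apply, mul_one, add_assoc, ← h1]
      refine add_le_add le_rfl ?_
      refine le_trans ?_ (add_le_add le_rfl (le_trans le_add_self h3))
      rw [← lintegral_add_left hm1]
      refine setLIntegral_mono' measurableSet_Icc fun s hs => ?_
      rw [← mul_add, ← ENNReal.tsum_add, ← h.rate.tsum_jumpRate]
      refine mul_le_mul_right (ENNReal.tsum_le_tsum fun z => ?_) _
      rw [← mul_add]
      exact le_mul_of_one_le_right' (ih (by linarith [hs.2]) z)
    · refine le_trans ?_ le_add_self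
      rw [← ENNReal.ofReal_one]
      refine ENNReal.ofReal_le_ofReal ?_
      have h1 : 1 ≤ (U x + D * t) / R := by
        rw [le_div_iff₀ hR]
        push Not at hx
        nlinarith [mul_nonneg hD ht]
      have : 0 ≤ (1 / 2 : ℝ) ^ (m + 1) * Real.exp (L * t) := by positivity
      linarith

/-- The chain is nonexplosive. -/
lemma semigroup_one [Countable S] (h : FosterLyapunov q U c D) {t : ℝ} (ht : 0 ≤ t) (x : S) :
    semigroup q t 1 x = 1 := by
  refine le_antisymm (h.rate.semigroup_one_le ht x) ?_
  -- First `m → ∞` with `R` fixed, which removes the Chernoff term, then `R → ∞`.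
  have h1 : ∀ R : ℝ, 0 < R → 1 ≤ semigroup q t 1 x + ENNReal.ofReal ((U x + D * t) / R) := by
    intro R hR
    obtain ⟨L, hL⟩ := ((h.finite_sublevel R).image fun x => -q x x).bddAbove
    have hL' : ∀ x, U x ≤ R → -q x x ≤ max L 0 := fun x hx =>
      (hL (mem_image_of_mem _ hx)).trans (le_max_left _ _)
    have hlim : Tendsto (fun m : ℕ => semigroup q t 1 x + ENNReal.ofReal ((U x + D * t) / R +
        (1 / 2) ^ m * Real.exp (max L 0 * t))) atTop
        (𝓝 (semigroup q t 1 x + ENNReal.ofReal ((U x + D * t) / R + 0 * Real.exp (max L 0 * t)))) := by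
      refine tendsto_const_nhds.add (ENNReal.tendsto_ofReal (tendsto_const_nhds.add ?_))
      exact (tendsto_pow_atTop_nhds_zero_of_lt_one (by norm_num) (by norm_num)).mul_const _
    rw [zero_mul, add_zero] at hlim
    refine ge_of_tendsto' hlim fun m => ?_
    refine (h.one_le_partialExp_add hR (le_max_right _ _) hL' m ht x).trans (add_le_add ?_ le_rfl)
    rw [semigroup_eq_iSup]
    exact le_iSup (fun m => partialExp q m 1 t x) m
  have hlim : Tendsto (fun R : ℝ => semigroup q t 1 x + ENNReal.ofReal ((U x + D * t) / R)) atTop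
      (𝓝 (semigroup q t 1 x + ENNReal.ofReal 0)) :=
    tendsto_const_nhds.add (ENNReal.tendsto_ofReal (tendsto_const_nhds.div_atTop tendsto_id))
  rw [ENNReal.ofReal_zero, add_zero] at hlim
  refine ge_of_tendsto hlim ?_
  filter_upwards [eventually_gt_atTop 0] with R hR using h1 R hR

end FosterLyapunov

lemma transition_self_pos (t : ℝ) (x : S) : 0 < transition q t x x := by
  refine lt_of_lt_of_le ?_ (ENNReal.le_tsum 0)
  rw [jumpTransition_zero_self]
  exact ENNReal.ofReal_pos.2 (Real.exp_pos _)

/-- The one-jump term suffices: wait at `x`, jump to `y`, stay there. Its integrand is bounded below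
by a positive constant on `[0, t]`. -/
lemma IsRateMatrix.transition_pos_of_rate_pos [Countable S] (hq : IsRateMatrix q) {x y : S}
    (hxy : 0 < q x y) {t : ℝ} (ht : 0 < t) : 0 < transition q t x y := by
  have hne : y ≠ x := by
    rintro rfl
    exact not_le.2 hxy (hq.diag_nonpos y)
  refine lt_of_lt_of_le ?_ (ENNReal.le_tsum 1)
  rw [jumpTransition_succ]
  have hle : ∀ s ∈ Icc 0 t, ENNReal.ofReal (Real.exp (q x x * t)) * (jumpRate q x y *
      ENNReal.ofReal (Real.exp (q y y * t))) ≤ ENNReal.ofReal (Real.exp (q x x * s)) *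
        ∑' z, jumpRate q x z * jumpTransition q 0 (t - s) z y := by
    intro s hs
    refine mul_le_mul' (ENNReal.ofReal_le_ofReal (Real.exp_le_exp.2 ?_)) ?_
    · nlinarith [hq.diag_nonpos x, hs.2]
    · refine le_trans ?_ (ENNReal.le_tsum y)
      rw [jumpTransition_zero_self]
      refine mul_le_mul_right (ENNReal.ofReal_le_ofReal (Real.exp_le_exp.2 ?_)) _
      nlinarith [hq.diag_nonpos y, hs.1]
  refine lt_of_lt_of_le ?_ (setLIntegral_mono' measurableSet_Icc hle)
  rw [setLIntegral_const, Real.volume_Icc, sub_zero]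
  have h1 : 0 < jumpRate q x y := by simpa [jumpRate, hne] using hxy
  have h2 := ENNReal.ofReal_pos.2 (Real.exp_pos (q x x * t))
  have h3 := ENNReal.ofReal_pos.2 (Real.exp_pos (q y y * t))
  have h4 := ENNReal.ofReal_pos.2 ht
  exact ENNReal.mul_pos (ENNReal.mul_pos h2.ne' (ENNReal.mul_pos h1.ne' h3.ne').ne').ne' h4.ne'

/-- All transition probabilities of an irreducible chain are positive at all positive times. -/
lemma IsIrreducibleRate.transition_pos [Countable S] (hirr : IsIrreducibleRate q)
    (hq : IsRateMatrix q) (x y : S) {t : ℝ} (ht : 0 < t) : 0 < transition q t x y := by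
  have h := hirr x y
  induction h generalizing t with
  | refl => exact transition_self_pos t x
  | @tail z w _ hzw ih =>
    have h2 : 0 < t / 2 := by positivity
    -- Half of the time is spent reaching `z`, the other half on the last transition.
    rw [← add_halves t, transition_add q h2.le h2.le]
    exact lt_of_lt_of_le (ENNReal.mul_pos (ih h2).ne' (hq.transition_pos_of_rate_pos hzw h2).ne')
      (ENNReal.le_tsum z)

end Drift

/-! ### Harris' theorem in weighted Lipschitz form. -/

section Harris

variable {S : Type*}

lemma summable_mul_of_bounded {p f : S → ℝ} (hp : Summable p) (hp0 : ∀ y, 0 ≤ p y) {M : ℝ}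
    (hf : ∀ y, |f y| ≤ M) : Summable fun y => p y * f y := by
  refine Summable.of_norm_bounded (hp.mul_right M) fun y => ?_
  rw [Real.norm_eq_abs, abs_mul, abs_of_nonneg (hp0 y)]
  exact mul_le_mul_of_nonneg_left (hf y) (hp0 y)

lemma abs_tsum_mul_le {p f : S → ℝ} (hp : HasSum p 1) (hp0 : ∀ y, 0 ≤ p y) {M : ℝ}
    (hf : ∀ y, |f y| ≤ M) : |∑' y, p y * f y| ≤ M := by
  have h : HasSum (fun y => p y * M) M := by simpa using hp.mul_right M
  rw [← Real.norm_eq_abs, ← h.tsum_eq]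
  refine tsum_of_norm_bounded h.summable.hasSum fun y => ?_
  rw [Real.norm_eq_abs, abs_mul, abs_of_nonneg (hp0 y)]
  exact mul_le_mul_of_nonneg_left (hf y) (hp0 y)

lemma abs_tsum_mul_le_of_le {p f g : S → ℝ} (hp0 : ∀ y, 0 ≤ p y) (hf : ∀ y, |f y| ≤ g y)
    (hg : Summable fun y => p y * g y) : |∑' y, p y * f y| ≤ ∑' y, p y * g y := by
  rw [← Real.norm_eq_abs]
  refine tsum_of_norm_bounded hg.hasSum fun y => ?_
  rw [Real.norm_eq_abs, abs_mul, abs_of_nonneg (hp0 y)]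
  exact mul_le_mul_of_nonneg_left (hf y) (hp0 y)

/-- Duality between the `ℓ¹` norm and functions bounded by one. -/
lemma sum_abs_sub_le_of_forall {p p' : S → ℝ} (hp : Summable p) (hp' : Summable p')
    (hp0 : ∀ y, 0 ≤ p y) (hp0' : ∀ y, 0 ≤ p' y) {B : ℝ}
    (h : ∀ f : S → ℝ, (∀ y, |f y| ≤ 1) → |(∑' y, p y * f y) - ∑' y, p' y * f y| ≤ B) (G : Finset S) :
    ∑ y ∈ G, |p y - p' y| ≤ B := by
  -- The extremal test function is the sign of `p - p'`.
  have hf : ∀ y, |((SignType.sign (p y - p' y) : ℤ) : ℝ)| ≤ 1 := fun y => by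
    rcases lt_trichotomy (p y - p' y) 0 with h | h | h <;> simp [h]
  have h1 := h _ hf
  rw [← (summable_mul_of_bounded hp hp0 hf).tsum_sub (summable_mul_of_bounded hp' hp0' hf)] at h1
  have h2 : ∀ y, p y * ((SignType.sign (p y - p' y) : ℤ) : ℝ) -
      p' y * ((SignType.sign (p y - p' y) : ℤ) : ℝ) = |p y - p' y| := fun y => by
    rw [← sub_mul, mul_comm]
    rcases lt_trichotomy (p y - p' y) 0 with h | h | h
    · simp [h, abs_of_neg]
    · simp [h]
    · simp [h, abs_of_pos]
  simp only [h2] at h1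
  exact ((hp.sub hp').abs.sum_le_tsum G fun _ _ => abs_nonneg _).trans ((le_abs_self _).trans h1)

/-- A function that is Lipschitz for the weighted metric `2 + b U x + b U y` can be shifted so
that it is bounded by the weight `1 + b U`. -/
lemma exists_shift_bounded [Nonempty S] {w f : S → ℝ} {A M : ℝ} (hA : 0 ≤ A) (hw : ∀ x, 0 ≤ w x)
    (hf : ∀ x, |f x| ≤ M) (hlip : ∀ x y, |f x - f y| ≤ A * (2 + w x + w y)) :
    ∃ s, ∀ x, |f x + s| ≤ A * (1 + w x) := by
  have hbdd : BddBelow (range fun x => A * (1 + w x) - f x) := by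
    refine ⟨-M, ?_⟩
    rintro _ ⟨x, rfl⟩
    have := mul_nonneg hA (add_nonneg zero_le_one (hw x))
    have := (abs_le.1 (hf x)).2
    simp only
    linarith
  -- The largest shift compatible with the upper bound; the Lipschitz bound then gives the lower
  -- one. Boundedness of `f` makes the infimum finite.
  refine ⟨⨅ x, (A * (1 + w x) - f x), fun x => abs_le.2 ⟨?_, ?_⟩⟩
  · have : -(A * (1 + w x)) - f x ≤ ⨅ x, (A * (1 + w x) - f x) := by
      refine le_ciInf fun y => ?_
      have := (abs_le.1 (hlip x y)).1
      linarith
    linarith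
  · have := ciInf_le hbdd x
    linarith

/-- Here `s` stands for `U x + U y`. When `s` is large, the drift alone contracts the weight. In
general the loss of mass `2 a` absorbs the constant `2 b K ≤ a` and still leaves a gain. The three
entries of the minimum are what these two estimates can afford. -/
lemma harris_arith {a b γ K s : ℝ} (hb : 0 < b) (hγ1 : γ < 1)
    (hs : 0 ≤ s) (hbK : 2 * b * K ≤ a) :
    (4 * K + 4 ≤ (1 - γ) * s →
      2 + b * (γ * s + 2 * K) ≤ (1 - min (a / 2) (min ((1 - γ) / 2) b)) * (2 + b * s)) ∧
    2 * (1 - a) + b * (γ * s + 2 * K) ≤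
      (1 - min (a / 2) (min ((1 - γ) / 2) b)) * (2 + b * s) := by
  set ε := min (a / 2) (min ((1 - γ) / 2) b)
  have h1 : ε ≤ a / 2 := min_le_left _ _
  have h2 : ε ≤ (1 - γ) / 2 := (min_le_right _ _).trans (min_le_left _ _)
  have h3 : ε ≤ b := (min_le_right _ _).trans (min_le_right _ _)
  have h4 : ε * (b * s) ≤ (1 - γ) / 2 * (b * s) :=
    mul_le_mul_of_nonneg_right h2 (mul_nonneg hb.le hs)
  refine ⟨fun h => ?_, ?_⟩
  · nlinarith [mul_le_mul_of_nonneg_left h hb.le]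
  · have : 0 ≤ (1 - γ) * (b * s) := mul_nonneg (by linarith) (mul_nonneg hb.le hs)
    nlinarith

/-- One step of Harris' theorem: a stochastic kernel with a Lyapunov function and a minorized
sublevel set contracts the weighted Lipschitz seminorm. -/
lemma harris_contraction [Nonempty S] {P : S → S → ℝ} {U : S → ℝ} {γ K a : ℝ} {y₀ : S}
    (hP0 : ∀ x y, 0 ≤ P x y) (hP : ∀ x, HasSum (P x) 1) (hU : ∀ x, 0 ≤ U x)
    (hγ : 0 ≤ γ) (hγ1 : γ < 1) (hK : 0 ≤ K) (ha : 0 < a)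
    (hPU : ∀ x, Summable fun y => P x y * U y)
    (hdrift : ∀ x, ∑' y, P x y * U y ≤ γ * U x + K)
    (hminor : ∀ x, U x ≤ (4 * K + 4) / (1 - γ) → a ≤ P x y₀) :
    ∃ b θ : ℝ, 0 < b ∧ 0 < θ ∧ θ < 1 ∧ ∀ (f : S → ℝ) (M A : ℝ), 0 ≤ A → (∀ x, |f x| ≤ M) →
      (∀ x y, |f x - f y| ≤ A * (2 + b * U x + b * U y)) →
      ∀ x y, |(∑' z, P x z * f z) - ∑' z, P y z * f z| ≤ θ * A * (2 + b * U x + b * U y) := by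
  classical
  -- The weight `b` must satisfy `2 b K ≤ a`; adding one to the denominator covers `K = 0`.
  have hbpos : 0 < a / (2 * K + 1) := by positivity
  have hbK : 2 * (a / (2 * K + 1)) * K ≤ a := by
    rw [show 2 * (a / (2 * K + 1)) * K = a * (2 * K) / (2 * K + 1) by ring, div_le_iff₀ (by positivity)]
    nlinarith
  set b := a / (2 * K + 1)
  have hε : 0 < min (a / 2) (min ((1 - γ) / 2) b) := by
    have : 0 < 1 - γ := by linarith
    positivity
  have hε1 : min (a / 2) (min ((1 - γ) / 2) b) < 1 :=
    ((min_le_right _ _).trans (min_le_left _ _)).trans_lt (by linarith)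
  refine ⟨b, 1 - min (a / 2) (min ((1 - γ) / 2) b), hbpos, by linarith, by linarith, ?_⟩
  intro f M A hA hfM hlip x y
  obtain ⟨s, hs⟩ := exists_shift_bounded (w := fun x => b * U x) hA
    (fun x => mul_nonneg hbpos.le (hU x)) hfM hlip
  have hshift : ∀ x, ∑' z, P x z * (f z + s) = (∑' z, P x z * f z) + s := by
    intro x
    simp only [mul_add]
    rw [(summable_mul_of_bounded (hP x).summable (hP0 x) hfM).tsum_add ((hP x).summable.mul_right s),
      tsum_mul_right, (hP x).tsum_eq, one_mul]
  have hsumw : ∀ x, HasSum (fun z => P x z * (A * (1 + b * U z)))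
      (A * (1 + b * ∑' z, P x z * U z)) := by
    intro x
    have e : (fun z => P x z * (A * (1 + b * U z))) =
        fun z => A * (P x z + b * (P x z * U z)) := by
      funext z
      ring
    rw [e]
    exact ((hP x).add ((hPU x).hasSum.mul_left b)).mul_left A
  have hsle : ∀ x, A * (1 + b * ∑' z, P x z * U z) ≤ A * (1 + b * (γ * U x + K)) := fun x =>
    mul_le_mul_of_nonneg_left (by nlinarith [hdrift x]) hA
  have harith := harris_arith (s := U x + U y) hbpos hγ1 (add_nonneg (hU x) (hU y)) hbK
  have hdiff : (∑' z, P x z * f z) - ∑' z, P y z * f z =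
      (∑' z, P x z * (f z + s)) - ∑' z, P y z * (f z + s) := by
    rw [hshift, hshift]; ring
  rw [hdiff]
  have h1γ : 0 < 1 - γ := by linarith
  by_cases hR : (4 * K + 4) / (1 - γ) ≤ U x + U y
  · rw [div_le_iff₀ h1γ] at hR
    have hx := (abs_tsum_mul_le_of_le (hP0 x) hs (hsumw x).summable).trans
      ((hsumw x).tsum_eq.le.trans (hsle x))
    have hy := (abs_tsum_mul_le_of_le (hP0 y) hs (hsumw y).summable).trans
      ((hsumw y).tsum_eq.le.trans (hsle y))
    have h3 := mul_le_mul_of_nonneg_left (harith.1 (by linarith)) hA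
    refine (abs_sub _ _).trans ((add_le_add hx hy).trans (le_trans (le_of_eq (by ring)) (h3.trans (le_of_eq (by ring)))))
  -- Both points now lie in the minorized sublevel set. The common mass `a` at `y₀` is removed from
  -- both kernels; it cancels in the difference and lowers each bound by at least `a A`.
  · push Not at hR
    have hmin : ∀ v, U v ≤ U x + U y → |(∑' z, P v z * (f z + s)) - a * (f y₀ + s)| ≤
        A * (1 + b * (γ * U v + K)) - a * A := by
      intro v hv
      have hv0 : ∀ z, 0 ≤ P v z - (Pi.single y₀ a : S → ℝ) z := by
        intro z
        by_cases hz : z = y₀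
        · subst hz
          simpa using hminor v (hv.trans hR.le)
        · simpa [hz] using hP0 v z
      have hsing : ∀ g : S → ℝ, HasSum (fun z => (Pi.single y₀ a : S → ℝ) z * g z) (a * g y₀) := by
        intro g
        have := hasSum_single (f := fun z => (Pi.single y₀ a : S → ℝ) z * g z) y₀
          (fun z hz => by simp [hz])
        simpa using this
      have hsA : ∀ y, |f y + s| ≤ M + |s| := fun y => (abs_add_le _ _).trans (by gcongr; exact hfM y)
      have e1 := ((summable_mul_of_bounded (hP v).summable (hP0 v) hsA).hasSum.sub
        (hsing fun z => f z + s))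
      have e2 := (hsumw v).sub (hsing fun z => A * (1 + b * U z))
      simp only [← sub_mul] at e1 e2
      rw [← e1.tsum_eq]
      refine (abs_tsum_mul_le_of_le hv0 hs e2.summable).trans (e2.tsum_eq.le.trans ?_)
      have : 0 ≤ a * (A * (b * U y₀)) := by
        have := hU y₀
        positivity
      linarith [hsle v]
    have hx := hmin x (by linarith [hU y])
    have hy := hmin y (by linarith [hU x])
    have h3 := mul_le_mul_of_nonneg_left harith.2 hA
    have h4 := (abs_sub_le (∑' z, P x z * (f z + s)) (a * (f y₀ + s)) (∑' z, P y z * (f z + s)))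
    rw [abs_sub_comm (a * (f y₀ + s))] at h4
    refine (h4.trans (add_le_add hx hy)).trans (le_trans (le_of_eq (by ring)) (h3.trans (le_of_eq (by ring))))

end Harris

/-! ### From contraction to exponential ergodicity and tail bounds. -/

section Ergodicity

variable {S : Type*} {q : S → S → ℝ}

/-- The transition probabilities as real numbers. -/
noncomputable def prob (q : S → S → ℝ) (t : ℝ) (x y : S) : ℝ := (transition q t x y).toReal

/-- The expectation of `f` at time `t`. -/
noncomputable def chainExp (q : S → S → ℝ) (t : ℝ) (f : S → ℝ) (x : S) : ℝ :=
  ∑' y, prob q t x y * f y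

lemma prob_nonneg (t : ℝ) (x y : S) : 0 ≤ prob q t x y := ENNReal.toReal_nonneg

namespace FosterLyapunov

variable {U : S → ℝ} {c D : ℝ} [Countable S]

lemma tsum_transition (h : FosterLyapunov q U c D) {t : ℝ} (ht : 0 ≤ t) (x : S) :
    ∑' y, transition q t x y = 1 := by
  have := h.semigroup_one ht x
  simpa [semigroup] using this

lemma transition_ne_top (h : FosterLyapunov q U c D) {t : ℝ} (ht : 0 ≤ t) (x y : S) :
    transition q t x y ≠ ⊤ :=
  ENNReal.ne_top_of_tsum_ne_top (by rw [h.tsum_transition ht x]; exact ENNReal.one_ne_top) y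

lemma ofReal_prob (h : FosterLyapunov q U c D) {t : ℝ} (ht : 0 ≤ t) (x y : S) :
    ENNReal.ofReal (prob q t x y) = transition q t x y :=
  ENNReal.ofReal_toReal (h.transition_ne_top ht x y)

lemma hasSum_prob (h : FosterLyapunov q U c D) {t : ℝ} (ht : 0 ≤ t) (x : S) :
    HasSum (prob q t x) 1 := by
  have := ENNReal.hasSum_toReal (f := transition q t x)
    (by rw [h.tsum_transition ht x]; exact ENNReal.one_ne_top)
  rwa [← ENNReal.tsum_toReal_eq (h.transition_ne_top ht x), h.tsum_transition ht x,
    ENNReal.toReal_one] at this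

lemma semigroup_ofReal (h : FosterLyapunov q U c D) {t : ℝ} (ht : 0 ≤ t) {f : S → ℝ}
    (hf : ∀ y, 0 ≤ f y) {x : S} (hs : Summable fun y => prob q t x y * f y) :
    semigroup q t (fun y => ENNReal.ofReal (f y)) x = ENNReal.ofReal (chainExp q t f x) := by
  rw [chainExp, ENNReal.ofReal_tsum_of_nonneg (fun y => mul_nonneg (prob_nonneg t x y) (hf y)) hs,
    semigroup]
  refine tsum_congr fun y => ?_
  rw [ENNReal.ofReal_mul (prob_nonneg t x y), h.ofReal_prob ht]

lemma summable_prob_mul (h : FosterLyapunov q U c D) {t : ℝ} (ht : 0 ≤ t) {f : S → ℝ} {M : ℝ}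
    (hf : ∀ y, |f y| ≤ M) (x : S) : Summable fun y => prob q t x y * f y :=
  summable_mul_of_bounded (h.hasSum_prob ht x).summable (prob_nonneg t x) hf

lemma abs_chainExp_le (h : FosterLyapunov q U c D) {t : ℝ} (ht : 0 ≤ t) {f : S → ℝ} {M : ℝ}
    (hf : ∀ y, |f y| ≤ M) (x : S) : |chainExp q t f x| ≤ M :=
  abs_tsum_mul_le (h.hasSum_prob ht x) (prob_nonneg t x) hf

lemma chainExp_add_const (h : FosterLyapunov q U c D) {t : ℝ} (ht : 0 ≤ t) {f : S → ℝ} {M : ℝ}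
    (hf : ∀ y, |f y| ≤ M) (a : ℝ) (x : S) :
    chainExp q t (fun y => f y + a) x = chainExp q t f x + a := by
  simp only [chainExp, mul_add]
  rw [(h.summable_prob_mul ht hf x).tsum_add ((h.hasSum_prob ht x).summable.mul_right a),
    tsum_mul_right, (h.hasSum_prob ht x).tsum_eq, one_mul]

/-- The semigroup law is known for nonnegative functions; adding the constant `M` carries it over to
bounded signed ones. -/
lemma chainExp_add (h : FosterLyapunov q U c D) {t s : ℝ} (ht : 0 ≤ t) (hs : 0 ≤ s) {f : S → ℝ}
    {M : ℝ} (hf : ∀ y, |f y| ≤ M) (x : S) :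
    chainExp q (t + s) f x = chainExp q t (chainExp q s f) x := by
  have hM : ∀ {g : S → ℝ}, (∀ y, |g y| ≤ M) → ∀ y, 0 ≤ g y + M := fun hg y => by
    linarith [(abs_le.1 (hg y)).1]
  have hM' : ∀ {g : S → ℝ}, (∀ y, |g y| ≤ M) → ∀ y, |g y + M| ≤ M + M := fun hg y => by
    rw [abs_of_nonneg (hM hg y)]
    linarith [(abs_le.1 (hg y)).2]
  have hg := h.abs_chainExp_le hs hf
  have e1 := h.semigroup_ofReal (add_nonneg ht hs) (hM hf)
    (h.summable_prob_mul (add_nonneg ht hs) (hM' hf) x)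
  have e2 := h.semigroup_ofReal ht (hM hg) (h.summable_prob_mul ht (hM' hg) x)
  have e3 : semigroup q s (fun y => ENNReal.ofReal (f y + M)) =
      fun y => ENNReal.ofReal (chainExp q s f y + M) := by
    funext y
    rw [h.semigroup_ofReal hs (hM hf) (h.summable_prob_mul hs (hM' hf) y),
      h.chainExp_add_const hs hf]
  rw [semigroup_add q ht hs, e3, e2, h.chainExp_add_const (add_nonneg ht hs) hf,
    h.chainExp_add_const ht hg] at e1
  have h1 : 0 ≤ chainExp q t (chainExp q s f) x + M := hM (h.abs_chainExp_le ht hg) x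
  have h2 : 0 ≤ chainExp q (t + s) f x + M := hM (h.abs_chainExp_le (add_nonneg ht hs) hf) x
  linarith [(ENNReal.ofReal_eq_ofReal_iff h1 h2).1 e1]

lemma prob_mul_lyapunov (h : FosterLyapunov q U c D) {t : ℝ} (ht : 0 ≤ t) (x : S) :
    Summable (fun y => prob q t x y * U y) ∧
      ∑' y, prob q t x y * U y ≤ Real.exp (-c * t) * U x + D / c := by
  have hle := h.semigroup_le ht x
  have hU := h.U_nonneg
  have h0 : 0 ≤ Real.exp (-c * t) * U x + D / c :=
    add_nonneg (mul_nonneg (Real.exp_nonneg _) (hU x)) (div_nonneg h.D_nonneg h.c_pos.le)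
  have hs : Summable fun y => prob q t x y * U y := by
    have := ENNReal.summable_toReal (ne_top_of_le_ne_top ENNReal.ofReal_ne_top hle)
    refine this.congr fun y => ?_
    rw [ENNReal.toReal_mul, ENNReal.toReal_ofReal (hU y), prob]
  refine ⟨hs, ?_⟩
  rw [h.semigroup_ofReal ht hU hs] at hle
  exact (ENNReal.ofReal_le_ofReal_iff h0).1 hle

/-- Geometric contraction of the semigroup along integer times, and hence along all times. -/
lemma exists_contraction [Nonempty S] (h : FosterLyapunov q U c D) (hirr : IsIrreducibleRate q) :
    ∃ b θ : ℝ, 0 < b ∧ 0 < θ ∧ θ < 1 ∧ ∀ t, 0 ≤ t → ∀ f : S → ℝ, (∀ x, |f x| ≤ 1) → ∀ x y,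
      |chainExp q t f x - chainExp q t f y| ≤ θ ^ ⌊t⌋₊ * (2 + b * U x + b * U y) := by
  classical
  obtain ⟨y₀⟩ := ‹Nonempty S›
  have hγ1 : Real.exp (-c * 1) < 1 := Real.exp_lt_one_iff.2 (by linarith [h.c_pos])
  -- The threshold of `harris_contraction` with `γ = e^(-c)` and `K = D/c`, the drift constants of
  -- the time-one kernel.
  set R := (4 * (D / c) + 4) / (1 - Real.exp (-c * 1))
  have hminor : ∃ a > 0, ∀ x, U x ≤ R → a ≤ prob q 1 x y₀ := by
    have hpos : ∀ x, 0 < prob q 1 x y₀ := fun x => ENNReal.toReal_pos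
      (hirr.transition_pos h.rate x y₀ one_pos).ne' (h.transition_ne_top zero_le_one x y₀)
    rcases (h.finite_sublevel R).toFinset.eq_empty_or_nonempty with hF | hF
    · refine ⟨1, one_pos, fun x hx => ?_⟩
      have : x ∈ (h.finite_sublevel R).toFinset := by simpa using hx
      simp [hF] at this
    · obtain ⟨x', _, hx'⟩ := Finset.exists_min_image _ (fun x => prob q 1 x y₀) hF
      exact ⟨prob q 1 x' y₀, hpos x', fun x hx => hx' x (by simpa using hx)⟩
  obtain ⟨a, ha, hminor⟩ := hminor
  have : Nonempty S := ⟨y₀⟩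
  obtain ⟨b, θ, hb, hθ, hθ1, hstep⟩ := harris_contraction (P := prob q 1) (U := U)
    (prob_nonneg 1) (h.hasSum_prob zero_le_one) h.U_nonneg (Real.exp_nonneg _) hγ1
    (div_nonneg h.D_nonneg h.c_pos.le) ha (fun x => (h.prob_mul_lyapunov zero_le_one x).1)
    (fun x => (h.prob_mul_lyapunov zero_le_one x).2) hminor
  refine ⟨b, θ, hb, hθ, hθ1, fun t ht f hf => ?_⟩
  -- Unit steps are added to the fractional part of `t`. At the start, `|f| ≤ 1` alone bounds the
  -- oscillation by `2`.
  have hnat : ∀ n : ℕ, ∀ x y, |chainExp q (n + (t - ⌊t⌋₊)) f x - chainExp q (n + (t - ⌊t⌋₊)) f y| ≤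
      θ ^ n * (2 + b * U x + b * U y) := by
    have hfr : 0 ≤ t - ⌊t⌋₊ := sub_nonneg.2 (Nat.floor_le ht)
    intro n
    induction n with
    | zero =>
      intro x y
      have h1 := h.abs_chainExp_le (add_nonneg (Nat.cast_nonneg 0) hfr) hf
      have h2 := (abs_sub _ _).trans (add_le_add (h1 x) (h1 y))
      have := mul_nonneg hb.le (h.U_nonneg x)
      have := mul_nonneg hb.le (h.U_nonneg y)
      rw [pow_zero, one_mul]
      linarith
    | succ n ih =>
      intro x y
      have hn : (0 : ℝ) ≤ n + (t - ⌊t⌋₊) := add_nonneg (Nat.cast_nonneg n) hfr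
      have e : ((n + 1 : ℕ) : ℝ) + (t - ⌊t⌋₊) = 1 + (n + (t - ⌊t⌋₊)) := by push_cast; ring
      rw [e, h.chainExp_add zero_le_one hn hf, h.chainExp_add zero_le_one hn hf, pow_succ']
      exact hstep _ 1 (θ ^ n) (by positivity) (h.abs_chainExp_le hn hf) ih x y
  have := hnat ⌊t⌋₊
  rwa [add_sub_cancel] at this

/-- An irreducible chain with a Foster–Lyapunov function is exponentially ergodic. -/
theorem isExponentiallyErgodic [Nonempty S] (h : FosterLyapunov q U c D)
    (hirr : IsIrreducibleRate q) : IsExponentiallyErgodic q := by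
  obtain ⟨b, θ, hb, hθ, hθ1, hcontr⟩ := h.exists_contraction hirr
  have hK : 0 ≤ D / c := div_nonneg h.D_nonneg h.c_pos.le
  set B : S → ℝ := fun x => 2 + b * (U x + D / c) + b * U x with hB
  have hB0 : ∀ x, 0 ≤ B x := fun x => by
    have := h.U_nonneg x
    positivity
  -- Conditioning at time `s` writes the difference as an average over `y` of `P_t f x - P_t f y`;
  -- the contraction and the moment bound for `U` give `B`.
  have hincr : ∀ t s : ℝ, 0 ≤ t → 0 ≤ s → ∀ f : S → ℝ, (∀ x, |f x| ≤ 1) → ∀ x,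
      |chainExp q t f x - chainExp q (t + s) f x| ≤ θ ^ ⌊t⌋₊ * B x := by
    intro t s ht hs f hf x
    have hg := h.abs_chainExp_le ht hf
    rw [add_comm t s, h.chainExp_add hs ht hf, abs_sub_comm, sub_eq_add_neg,
      ← h.chainExp_add_const hs hg]
    obtain ⟨hs1, hs2⟩ := h.prob_mul_lyapunov hs x
    have hsum : HasSum (fun y => prob q s x y * (θ ^ ⌊t⌋₊ * (2 + b * U y + b * U x)))
        (θ ^ ⌊t⌋₊ * (2 + b * (∑' y, prob q s x y * U y) + b * U x)) := by
      have e : (fun y => prob q s x y * (θ ^ ⌊t⌋₊ * (2 + b * U y + b * U x))) = fun y =>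
          θ ^ ⌊t⌋₊ * (prob q s x y * (2 + b * U x) + b * (prob q s x y * U y)) := by
        funext y
        ring
      have e' : 2 + b * (∑' y, prob q s x y * U y) + b * U x =
          1 * (2 + b * U x) + b * ∑' y, prob q s x y * U y := by ring
      rw [e, e']
      exact (((h.hasSum_prob hs x).mul_right _).add (hs1.hasSum.mul_left b)).mul_left _
    refine (abs_tsum_mul_le_of_le (prob_nonneg s x) (fun y => ?_) hsum.summable).trans
      (hsum.tsum_eq.le.trans ?_)
    · exact hcontr t ht f hf y x
    · refine mul_le_mul_of_nonneg_left ?_ (by positivity)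
      have : Real.exp (-c * s) ≤ 1 := Real.exp_le_one_iff.2 (by nlinarith [h.c_pos])
      have := h.U_nonneg x
      have : (∑' y, prob q s x y * U y) ≤ U x + D / c := by nlinarith
      simp only [hB]
      nlinarith
  have hl1 : ∀ t s : ℝ, 0 ≤ t → 0 ≤ s → ∀ x, ∀ G : Finset S,
      ∑ y ∈ G, |prob q t x y - prob q (t + s) x y| ≤ θ ^ ⌊t⌋₊ * B x := fun t s ht hs x G =>
    sum_abs_sub_le_of_forall (h.hasSum_prob ht x).summable
      (h.hasSum_prob (add_nonneg ht hs) x).summable (prob_nonneg _ _) (prob_nonneg _ _)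
      (fun f hf => hincr t s ht hs f hf x) G
  have hl2 : ∀ t : ℝ, 0 ≤ t → ∀ x x', ∀ G : Finset S,
      ∑ y ∈ G, |prob q t x y - prob q t x' y| ≤ θ ^ ⌊t⌋₊ * (2 + b * U x + b * U x') :=
    fun t ht x x' G =>
    sum_abs_sub_le_of_forall (h.hasSum_prob ht x).summable
      (h.hasSum_prob ht x').summable (prob_nonneg _ _) (prob_nonneg _ _)
      (fun f hf => hcontr t ht f hf x x') G
  obtain ⟨x₀⟩ := ‹Nonempty S›
  -- The invariant law is the pointwise limit along integer times from a fixed state. The `ℓ¹`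
  -- bounds pass to this limit on finite sets first.
  have hθn : Tendsto (fun n : ℕ => θ ^ n) atTop (𝓝 0) :=
    tendsto_pow_atTop_nhds_zero_of_lt_one hθ.le hθ1
  have hlim : ∀ y, ∃ l, Tendsto (fun n : ℕ => prob q n x₀ y) atTop (𝓝 l) := by
    intro y
    refine cauchySeq_tendsto_of_complete (cauchySeq_of_le_geometric θ (B x₀) hθ1 fun n => ?_)
    have := hl1 n 1 (Nat.cast_nonneg n) zero_le_one x₀ {y}
    rw [Finset.sum_singleton, Nat.floor_natCast] at this
    rw [Real.dist_eq, mul_comm]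
    exact_mod_cast this
  choose ν hν using hlim
  have hν0 : ∀ y, 0 ≤ ν y := fun y => ge_of_tendsto' (hν y) fun n => prob_nonneg _ _ _
  have htv : ∀ t : ℝ, 0 ≤ t → ∀ x, ∀ G : Finset S,
      ∑ y ∈ G, |prob q t x y - ν y| ≤ θ ^ ⌊t⌋₊ * B x := by
    intro t ht x G
    have hL : Tendsto (fun n : ℕ => ∑ y ∈ G, |prob q t x y - prob q n x₀ y|) atTop
        (𝓝 (∑ y ∈ G, |prob q t x y - ν y|)) :=
      tendsto_finsetSum _ fun y _ => (tendsto_const_nhds.sub (hν y)).abs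
    have hR : Tendsto (fun n : ℕ => θ ^ ⌊t⌋₊ * B x + θ ^ n * (2 + b * U x + b * U x₀)) atTop
        (𝓝 (θ ^ ⌊t⌋₊ * B x + 0 * (2 + b * U x + b * U x₀))) :=
      tendsto_const_nhds.add (hθn.mul_const _)
    rw [zero_mul, add_zero] at hR
    refine le_of_tendsto_of_tendsto hL hR ?_
    filter_upwards [eventually_ge_atTop ⌈t⌉₊] with n hn
    have hn' : 0 ≤ (n : ℝ) - t := sub_nonneg.2 (Nat.ceil_le.1 hn)
    have h1 := hl1 t (n - t) ht hn' x G
    have h2 := hl2 n (Nat.cast_nonneg n) x x₀ G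
    rw [add_sub_cancel] at h1
    rw [Nat.floor_natCast] at h2
    refine le_trans ?_ (add_le_add h1 h2)
    rw [← Finset.sum_add_distrib]
    exact Finset.sum_le_sum fun y _ => abs_sub_le _ _ _
  have htvs : ∀ t : ℝ, 0 ≤ t → ∀ x, Summable fun y => |prob q t x y - ν y| := fun t ht x =>
    summable_of_sum_le (fun _ => abs_nonneg _) (htv t ht x)
  have htvt : ∀ t : ℝ, 0 ≤ t → ∀ x, ∑' y, |prob q t x y - ν y| ≤ θ ^ ⌊t⌋₊ * B x := fun t ht x =>
    (htvs t ht x).tsum_le_of_sum_le (htv t ht x)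
  have hνs : Summable ν := by
    have := (h.hasSum_prob le_rfl x₀).summable.sub (htvs 0 le_rfl x₀).of_abs
    simpa using this
  have hν1 : HasSum ν 1 := by
    have hle : ∀ n : ℕ, |1 - ∑' y, ν y| ≤ θ ^ n * B x₀ := by
      intro n
      have hn : (0 : ℝ) ≤ n := Nat.cast_nonneg n
      rw [← (h.hasSum_prob hn x₀).tsum_eq, ← (h.hasSum_prob hn x₀).summable.tsum_sub hνs,
        ← Real.norm_eq_abs]
      refine (tsum_of_norm_bounded (htvs n hn x₀).hasSum fun y => le_rfl).trans ?_
      simpa using htvt n hn x₀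
    have h0 : |1 - ∑' y, ν y| ≤ 0 := by
      refine ge_of_tendsto' (x := atTop) (f := fun n : ℕ => θ ^ n * B x₀) ?_ hle
      simpa using hθn.mul_const (B x₀)
    have : ∑' y, ν y = 1 := by linarith [abs_eq_zero.1 (le_antisymm h0 (abs_nonneg _))]
    rw [← this]
    exact hνs.hasSum
  have hpmf : HasSum (fun y => ENNReal.ofReal (ν y)) 1 := by
    rw [ENNReal.summable.hasSum_iff, ← ENNReal.ofReal_tsum_of_nonneg hν0 hνs, hν1.tsum_eq,
      ENNReal.ofReal_one]
  -- The factor `θ⁻¹` pays for replacing `θ ^ ⌊t⌋₊` by `θ ^ t`.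
  refine ⟨⟨fun y => ENNReal.ofReal (ν y), hpmf⟩, ?_, -Real.log θ, fun x => θ⁻¹ * B x,
    by linarith [Real.log_neg hθ hθ1], ?_⟩
  · intro t ht y
    change ∑' x, ENNReal.ofReal (ν x) * transition q t x y = ENNReal.ofReal (ν y)
    have hp1 : ∀ x, |prob q t x y| ≤ 1 := fun x => by
      rw [abs_of_nonneg (prob_nonneg _ _ _)]
      exact le_hasSum (h.hasSum_prob ht x) y fun _ _ => prob_nonneg _ _ _
    have hsν := summable_mul_of_bounded hνs hν0 hp1
    have e : ∀ x, ENNReal.ofReal (ν x) * transition q t x y =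
        ENNReal.ofReal (ν x * prob q t x y) := fun x => by
      rw [ENNReal.ofReal_mul (hν0 x), h.ofReal_prob ht]
    simp only [e]
    rw [← ENNReal.ofReal_tsum_of_nonneg (fun x => mul_nonneg (hν0 x) (prob_nonneg _ _ _)) hsν]
    congr 1
    have hck : ∀ n : ℕ, prob q (n + t) x₀ y = ∑' x, prob q n x₀ x * prob q t x y := by
      intro n
      have hn : (0 : ℝ) ≤ n := Nat.cast_nonneg n
      rw [prob, transition_add q hn ht, ENNReal.tsum_toReal_eq fun x =>
        ENNReal.mul_ne_top (h.transition_ne_top hn _ _) (h.transition_ne_top ht _ _)]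
      simp only [ENNReal.toReal_mul, prob]
    -- Both `ν P_t` and `ν` are compared with the law at time `n + t` from `x₀`, using `P_(n+t) =
    -- P_n P_t`.
    have hle : ∀ n : ℕ, |(∑' x, ν x * prob q t x y) - ν y| ≤ 2 * (θ ^ n * B x₀) := by
      intro n
      have hn : (0 : ℝ) ≤ n := Nat.cast_nonneg n
      have h1 : |(∑' x, ν x * prob q t x y) - prob q (n + t) x₀ y| ≤ θ ^ n * B x₀ := by
        rw [hck, abs_sub_comm, ← (summable_mul_of_bounded (h.hasSum_prob hn x₀).summable
          (prob_nonneg _ _) hp1).tsum_sub hsν, ← Real.norm_eq_abs]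
        refine (tsum_of_norm_bounded (htvs n hn x₀).hasSum fun x => ?_).trans ?_
        · rw [← sub_mul, norm_mul, Real.norm_eq_abs, Real.norm_eq_abs]
          exact mul_le_of_le_one_right (abs_nonneg _) (hp1 x)
        · simpa using htvt n hn x₀
      have h2 : |prob q (n + t) x₀ y - ν y| ≤ θ ^ n * B x₀ := by
        have := htv (n + t) (add_nonneg hn ht) x₀ {y}
        rw [Finset.sum_singleton] at this
        refine this.trans (mul_le_mul_of_nonneg_right ?_ (hB0 x₀))
        exact pow_le_pow_of_le_one hθ.le hθ1.le (Nat.le_floor (by linarith))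
      linarith [abs_sub_le (∑' x, ν x * prob q t x y) (prob q (n + t) x₀ y) (ν y)]
    have h0 : |(∑' x, ν x * prob q t x y) - ν y| ≤ 0 := by
      refine ge_of_tendsto' (x := atTop) (f := fun n : ℕ => 2 * (θ ^ n * B x₀)) ?_ hle
      simpa using (hθn.mul_const (B x₀)).const_mul 2
    linarith [abs_eq_zero.1 (le_antisymm h0 (abs_nonneg _))]
  · intro t ht x
    have hfun : ∀ y, ENNReal.ofReal |(transition q t x y).toReal -
        (ENNReal.ofReal (ν y)).toReal| = ENNReal.ofReal |prob q t x y - ν y| := fun y => by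
      rw [ENNReal.toReal_ofReal (hν0 y), prob]
    change ∑' y, ENNReal.ofReal |(transition q t x y).toReal - (ENNReal.ofReal (ν y)).toReal| ≤ _
    simp only [hfun]
    rw [← ENNReal.ofReal_tsum_of_nonneg (fun _ => abs_nonneg _) (htvs t ht x)]
    refine ENNReal.ofReal_le_ofReal ((htvt t ht x).trans ?_)
    have h1 : Real.exp (- -Real.log θ * t) = θ ^ t := by
      rw [neg_neg, Real.rpow_def_of_pos hθ]
    have h2 : θ ^ ⌊t⌋₊ ≤ θ⁻¹ * θ ^ t := by
      rw [← Real.rpow_natCast, ← Real.rpow_neg_one, ← Real.rpow_add hθ]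
      exact Real.rpow_le_rpow_of_exponent_ge hθ hθ1.le (by linarith [Nat.lt_floor_add_one t])
    rw [h1]
    calc θ ^ ⌊t⌋₊ * B x ≤ θ⁻¹ * θ ^ t * B x := mul_le_mul_of_nonneg_right h2 (hB0 x)
      _ = _ := by ring

/-- Markov's inequality for every invariant law, with the constant from the drift condition. -/
lemma invariantLaw_tail_le (h : FosterLyapunov q U c D) {μ : PMF S} (hμ : IsInvariantLaw q μ)
    {R : ℝ} (hR : 0 < R) :
    ∑' x, {x | R < U x}.indicator μ x ≤ ENNReal.ofReal (D / c / R) := by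
  classical
  have hK : 0 ≤ D / c := div_nonneg h.D_nonneg h.c_pos.le
  have hsg : ∀ t : ℝ, 0 ≤ t → ∀ x, semigroup q t ({x | R < U x}.indicator 1) x ≤
      ENNReal.ofReal ((Real.exp (-c * t) * U x + D / c) / R) := by
    intro t ht x
    rw [div_eq_inv_mul, ENNReal.ofReal_mul (by positivity)]
    refine le_trans ?_ (mul_le_mul_right (h.semigroup_le ht x) _)
    rw [semigroup, semigroup, ← ENNReal.tsum_mul_left]
    refine ENNReal.tsum_le_tsum fun y => ?_
    rw [mul_left_comm]
    refine mul_le_mul_right ?_ _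
    by_cases hy : R < U y
    · rw [indicator_of_mem (by exact hy), Pi.one_apply, ← ENNReal.ofReal_mul (by positivity),
        ← ENNReal.ofReal_one, ← div_eq_inv_mul]
      exact ENNReal.ofReal_le_ofReal ((one_le_div hR).2 hy.le)
    · rw [indicator_of_notMem (by exact hy)]
      exact zero_le
  have hsg1 : ∀ t : ℝ, 0 ≤ t → ∀ x, semigroup q t ({x | R < U x}.indicator 1) x ≤ 1 := by
    intro t ht x
    refine le_trans ?_ (h.rate.semigroup_one_le ht x)
    refine ENNReal.tsum_le_tsum fun y => mul_le_mul_right ?_ _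
    exact indicator_le_self _ _ y
  have hinv : ∀ t : ℝ, 0 ≤ t → ∑' x, {x | R < U x}.indicator μ x =
      ∑' x, μ x * semigroup q t ({x | R < U x}.indicator 1) x := by
    intro t ht
    simp only [semigroup, ← ENNReal.tsum_mul_left]
    rw [ENNReal.tsum_comm]
    refine tsum_congr fun y => ?_
    simp only [← mul_assoc]
    rw [ENNReal.tsum_mul_right, hμ t ht y]
    by_cases hy : y ∈ {x | R < U x}
    · rw [indicator_of_mem hy, indicator_of_mem hy, Pi.one_apply, mul_one]
    · rw [indicator_of_notMem hy, indicator_of_notMem hy, mul_zero]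
  -- An invariant law is not known in advance to integrate `U`. On a finite set `G` the initial
  -- value of `U` is bounded and forgotten as `t → ∞`; off `G` the trivial bound one is used, and
  -- `G` then exhausts the state space.
  have hG : ∀ G : Finset S, ∑' x, {x | R < U x}.indicator μ x ≤
      ENNReal.ofReal (D / c / R) + ∑' x : {x // x ∉ G}, μ x := by
    intro G
    have hUG : ∀ x ∈ G, U x ≤ ∑ y ∈ G, U y := fun x hx =>
      Finset.single_le_sum (fun y _ => h.U_nonneg y) hx
    set N := ∑ y ∈ G, U y
    have hT : ∀ t : ℝ, 0 ≤ t → ∑' x, {x | R < U x}.indicator μ x ≤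
        ENNReal.ofReal ((Real.exp (-c * t) * N + D / c) / R) + ∑' x : {x // x ∉ G}, μ x := by
      intro t ht
      rw [hinv t ht]
      have e1 : ∑' x : {x // x ∉ G}, μ x = ∑' x, {x | x ∉ G}.indicator μ x :=
        tsum_subtype {x | x ∉ G} μ
      have e2 : ENNReal.ofReal ((Real.exp (-c * t) * N + D / c) / R) =
          ∑' x, μ x * ENNReal.ofReal ((Real.exp (-c * t) * N + D / c) / R) := by
        rw [ENNReal.tsum_mul_right, μ.tsum_coe, one_mul]
      rw [e1, e2, ← ENNReal.tsum_add]
      refine ENNReal.tsum_le_tsum fun x => ?_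
      by_cases hx : x ∈ G
      · refine le_trans (mul_le_mul_right ((hsg t ht x).trans
          (ENNReal.ofReal_le_ofReal ?_)) _) le_self_add
        have := hUG x hx
        gcongr
      · refine le_trans ?_ le_add_self
        rw [indicator_of_mem (by exact hx)]
        exact mul_le_of_le_one_right' (hsg1 t ht x)
    have hlim : Tendsto (fun t : ℝ => ENNReal.ofReal ((Real.exp (-c * t) * N + D / c) / R) +
        ∑' x : {x // x ∉ G}, μ x) atTop
        (𝓝 (ENNReal.ofReal ((0 * N + D / c) / R) + ∑' x : {x // x ∉ G}, μ x)) := by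
      have hexp : Tendsto (fun t : ℝ => Real.exp (-c * t)) atTop (𝓝 0) :=
        Real.tendsto_exp_atBot.comp (tendsto_id.const_mul_atTop_of_neg (by linarith [h.c_pos]))
      exact (ENNReal.tendsto_ofReal (((hexp.mul_const N).add_const _).div_const R)).add_const _
    rw [zero_mul, zero_add] at hlim
    refine ge_of_tendsto hlim ?_
    filter_upwards [eventually_ge_atTop 0] with t ht using hT t ht
  have hlim := (ENNReal.tendsto_tsum_compl_atTop_zero (f := μ)
    (by rw [μ.tsum_coe]; exact ENNReal.one_ne_top)).const_add (ENNReal.ofReal (D / c / R))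
  rw [add_zero] at hlim
  exact ge_of_tendsto' hlim hG

end FosterLyapunov

end Ergodicity

/-! ### The Poisson equation for the modulating chain. -/

section Poisson

variable {ι : Type*} [Fintype ι] {Q : ι → ι → ℝ}

lemma IsRateMatrix.sum_row (hQ : IsRateMatrix Q) (k : ι) : ∑ m, Q k m = 0 :=
  (hasSum_fintype (Q k)).unique (hQ.row_sum k)

/-- The harmonic functions of an irreducible rate matrix are constant. -/
lemma IsIrreducibleRate.eq_of_harmonic (hQ : IsRateMatrix Q) (hirr : IsIrreducibleRate Q)
    {f : ι → ℝ} (hf : ∀ k, ∑ m, Q k m * f m = 0) (k l : ι) : f k = f l := by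
  obtain ⟨x, -, hx⟩ := Finset.exists_max_image Finset.univ f ⟨k, Finset.mem_univ k⟩
  -- Maximum principle: at a maximizer, harmonicity is a vanishing sum of nonnegative terms.
  have hstep : ∀ a b, f a = f x → 0 < Q a b → f b = f x := by
    intro a b ha hab
    have h0 : ∑ m, Q a m * (f x - f m) = 0 := by
      simp only [mul_sub, Finset.sum_sub_distrib]
      rw [← Finset.sum_mul, hQ.sum_row, hf, zero_mul, sub_zero]
    have hnn : ∀ m ∈ Finset.univ, 0 ≤ Q a m * (f x - f m) := by
      intro m hm
      by_cases ham : a = m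
      · subst ham
        rw [ha, sub_self, mul_zero]
      · exact mul_nonneg (hQ.offdiag_nonneg a m ham) (sub_nonneg.2 (hx m hm))
    have := (Finset.sum_eq_zero_iff_of_nonneg hnn).1 h0 b (Finset.mem_univ b)
    rcases mul_eq_zero.1 this with h | h
    · exact absurd h hab.ne'
    · linarith
  have hall : ∀ y, f y = f x := by
    intro y
    induction hirr x y with
    | refl => rfl
    | tail _ hab ih => exact hstep _ _ ih hab
  rw [hall k, hall l]

/-- Solvability of the Poisson equation `Q T = 1 π - I`. -/
lemma exists_poisson [DecidableEq ι] (hQ : IsRateMatrix Q) (hirr : IsIrreducibleRate Q) {π : ι → ℝ}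
    (hπ : ∑ k, π k = 1) (hinv : ∀ l, ∑ k, π k * Q k l = 0) :
    ∃ T : ι → ι → ℝ, ∀ k l, ∑ m, Q k m * T m l = π l - if k = l then 1 else 0 := by
  have hπQ : ∀ f : ι → ℝ, ∑ k, π k * ∑ m, Q k m * f m = 0 := by
    intro f
    simp only [Finset.mul_sum, ← mul_assoc]
    rw [Finset.sum_comm]
    simp only [← Finset.sum_mul, hinv, zero_mul, Finset.sum_const_zero]
  -- Subtracting the projection `1 π` removes the constants from the kernel of `Q`, so `L` is
  -- injective, hence surjective in finite dimension.
  let L : (ι → ℝ) →ₗ[ℝ] (ι → ℝ) :=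
    Matrix.toLin' (Matrix.of fun k m => Q k m - π m)
  have hL : ∀ f k, L f k = ∑ m, Q k m * f m - ∑ m, π m * f m := by
    intro f k
    simp only [L, Matrix.toLin'_apply, Matrix.mulVec, dotProduct, Matrix.of_apply, sub_mul,
      Finset.sum_sub_distrib]
  have hπL : ∀ f, ∑ k, π k * L f k = -∑ m, π m * f m := by
    intro f
    simp only [hL, mul_sub, Finset.sum_sub_distrib]
    rw [hπQ, ← Finset.sum_mul, hπ]
    ring
  have hinj : Function.Injective L := by
    rw [injective_iff_map_eq_zero]
    intro f hf
    have h1 : ∑ m, π m * f m = 0 := by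
      have := hπL f
      simp only [hf, Pi.zero_apply, mul_zero, Finset.sum_const_zero] at this
      linarith
    have h2 : ∀ k, ∑ m, Q k m * f m = 0 := by
      intro k
      have := hL f k
      rw [hf, h1, sub_zero] at this
      exact this.symm
    funext k
    have h3 : ∀ m, π m * f m = π m * f k := fun m => by rw [hirr.eq_of_harmonic hQ h2 m k]
    simp only [h3, ← Finset.sum_mul, hπ, one_mul] at h1
    exact h1
  have hsurj := LinearMap.surjective_of_injective hinj
  choose T hT using fun l : ι => hsurj fun k => π l - if k = l then 1 else 0
  refine ⟨fun m l => T l m, fun k l => ?_⟩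
  -- The right-hand side has `π`-mean zero, so the solution does too, and the rank-one term
  -- disappears.
  have h1 : ∑ m, π m * T l m = 0 := by
    have := hπL (T l)
    rw [hT] at this
    simp only [mul_sub, Finset.sum_sub_distrib, ← Finset.sum_mul, hπ, mul_ite, mul_one,
      mul_zero, Finset.sum_ite_eq', Finset.mem_univ, if_true, one_mul, sub_self] at this
    linarith
  have h2 := hL (T l) k
  rw [hT, h1, sub_zero] at h2
  exact h2.symm

end Poisson

/-! ### Scaled generators and their first and second differences. -/

namespace ModulatedModel

variable {d k₀ : ℕ} (M : ModulatedModel d k₀) (xs : ℕ → EuclideanSpace ℝ (Fin d))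

/-- The space part of the generator of the scaled process in regime `k`. -/
noncomputable def spaceGen (n : ℕ) (k : Fin k₀) (f : EuclideanSpace ℝ (Fin d) → ℝ)
    (x : EuclideanSpace ℝ (Fin d)) : ℝ :=
  ∑ᶠ z ∈ M.jumps n k (M.unscale xs n x),
    M.r n k (M.unscale xs n x) (M.unscale xs n x + z) * (f (x + (n : ℝ) ^ (-M.β) • z) - f x)

variable {M xs} {n : ℕ}

lemma unscale_add_smul (hn : 1 ≤ n) (x z : EuclideanSpace ℝ (Fin d)) :
    M.unscale xs n (x + (n : ℝ) ^ (-M.β) • z) = M.unscale xs n x + z := by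
  have hn' : (0 : ℝ) < n := by exact_mod_cast hn
  rw [unscale, unscale, smul_add, smul_smul, ← Real.rpow_add hn', add_neg_cancel, Real.rpow_zero,
    one_smul]
  abel

lemma unscale_scale (hn : 1 ≤ n) (x : EuclideanSpace ℝ (Fin d)) :
    M.unscale xs n (M.scale xs n x) = x := by
  have hn' : (0 : ℝ) < n := by exact_mod_cast hn
  rw [unscale, scale, smul_smul, ← Real.rpow_add hn', add_neg_cancel, Real.rpow_zero, one_smul]
  abel

lemma scale_unscale (hn : 1 ≤ n) (x : EuclideanSpace ℝ (Fin d)) :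
    M.scale xs n (M.unscale xs n x) = x := by
  have hn' : (0 : ℝ) < n := by exact_mod_cast hn
  rw [unscale, scale, add_sub_cancel_right, smul_smul, ← Real.rpow_add hn', neg_add_cancel,
    Real.rpow_zero, one_smul]

lemma mem_hatX_iff (hn : 1 ≤ n) {x : EuclideanSpace ℝ (Fin d)} :
    x ∈ M.hatX xs n ↔ M.unscale xs n x ∈ M.X n := by
  constructor
  · rintro ⟨y, hy, rfl⟩
    rwa [unscale_scale hn]
  · intro h
    exact ⟨_, h, scale_unscale hn x⟩

lemma mem_of_mem_jumps (hn : 1 ≤ n) {k : Fin k₀} {x z : EuclideanSpace ℝ (Fin d)}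
    (hz : z ∈ M.jumps n k x) : x ∈ M.X n ∧ x + z ∈ M.X n := by
  by_contra h
  have := M.r_zero n hn k x (x + z) h
  have hz' : 0 < M.r n k x (x + z) := hz
  linarith

lemma add_mem_hatX (hn : 1 ≤ n) {k : Fin k₀} {x z : EuclideanSpace ℝ (Fin d)}
    (hz : z ∈ M.jumps n k (M.unscale xs n x)) : x + (n : ℝ) ^ (-M.β) • z ∈ M.hatX xs n := by
  rw [mem_hatX_iff hn, unscale_add_smul hn]
  exact (mem_of_mem_jumps hn hz).2

lemma ne_zero_of_mem_jumps (hn : 1 ≤ n) {k : Fin k₀} {x z : EuclideanSpace ℝ (Fin d)}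
    (hz : z ∈ M.jumps n k x) : z ≠ 0 := by
  rintro rfl
  have hx := (mem_of_mem_jumps hn hz).1
  have h1 : 0 < M.r n k x (x + 0) := hz
  rw [add_zero] at h1
  have := (M.r_rate n hn k).diag_nonpos ⟨x, hx⟩
  simp only at this
  linarith

lemma r_nonneg (hn : 1 ≤ n) (k : Fin k₀) (x : EuclideanSpace ℝ (Fin d))
    {z : EuclideanSpace ℝ (Fin d)} (hz : z ≠ 0) : 0 ≤ M.r n k x (x + z) := by
  by_cases h : x ∈ M.X n ∧ x + z ∈ M.X n
  · exact (M.r_rate n hn k).offdiag_nonneg ⟨x, h.1⟩ ⟨x + z, h.2⟩ (by simpa using hz)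
  · exact (M.r_zero n hn k x _ h).ge

lemma r_eq_zero (hn : 1 ≤ n) {k : Fin k₀} {x z : EuclideanSpace ℝ (Fin d)} (hz : z ≠ 0)
    (hzj : z ∉ M.jumps n k x) : M.r n k x (x + z) = 0 :=
  le_antisymm (not_lt.1 hzj) (r_nonneg hn k x hz)

lemma scale_pow_pos (hn : 1 ≤ n) (a : ℝ) : (0 : ℝ) < (n : ℝ) ^ a :=
  Real.rpow_pos_of_pos (by exact_mod_cast hn) a

section

variable {m₀ C₀ : ℝ} {N₀ : ℕ} (hM : M.Structural xs m₀ N₀ C₀)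
include hM

lemma Structural.norm_le (hn : 1 ≤ n) {k : Fin k₀} {x z : EuclideanSpace ℝ (Fin d)}
    (hz : z ∈ M.jumps n k x) : ‖z‖ ≤ m₀ := by
  by_contra h
  have h1 := hM.bounded_jumps n hn k x (mem_of_mem_jumps hn hz).1 z (not_le.1 h)
  have hz' : 0 < M.r n k x (x + z) := hz
  linarith

lemma Structural.exists_finset (hn : 1 ≤ n) (k : Fin k₀) {x : EuclideanSpace ℝ (Fin d)}
    (hx : x ∈ M.X n) : ∃ F : Finset (EuclideanSpace ℝ (Fin d)), ↑F = M.jumps n k x ∧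
      F.card ≤ N₀ := by
  have h := hM.finite_jumps n hn k x hx
  have hfin : (M.jumps n k x).Finite :=
    Set.finite_of_encard_le_coe h
  refine ⟨hfin.toFinset, hfin.coe_toFinset, ?_⟩
  rw [hfin.encard_eq_coe_toFinset_card] at h
  exact_mod_cast h

end

/-- Off the jump set only `z = 0` can have a nonzero rate, the negative diagonal entry, and there
`g` vanishes. Sums over different jump sets can thus be taken over one finite set. -/
lemma finsum_jumps_eq_sum (hn : 1 ≤ n) {k : Fin k₀} {x : EuclideanSpace ℝ (Fin d)}
    {F : Finset (EuclideanSpace ℝ (Fin d))} (hF : M.jumps n k x ⊆ F)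
    {g : EuclideanSpace ℝ (Fin d) → ℝ} (hg : g 0 = 0) :
    ∑ᶠ z ∈ M.jumps n k x, M.r n k x (x + z) * g z = ∑ z ∈ F, M.r n k x (x + z) * g z := by
  refine finsum_mem_eq_sum_of_inter_support_eq _ ?_
  ext z
  simp only [mem_inter_iff, Function.mem_support, Finset.mem_coe]
  refine ⟨fun h => ⟨hF h.1, h.2⟩, fun h => ⟨?_, h.2⟩⟩
  by_contra hz
  refine h.2 ?_
  by_cases hz0 : z = 0
  · rw [hz0, hg, mul_zero]
  · rw [r_eq_zero hn hz0 hz, zero_mul]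

lemma spaceGen_eq_sum (hn : 1 ≤ n) {k : Fin k₀} {x : EuclideanSpace ℝ (Fin d)}
    {F : Finset (EuclideanSpace ℝ (Fin d))} (hF : M.jumps n k (M.unscale xs n x) ⊆ F)
    (f : EuclideanSpace ℝ (Fin d) → ℝ) :
    M.spaceGen xs n k f x = ∑ z ∈ F, M.r n k (M.unscale xs n x) (M.unscale xs n x + z) *
      (f (x + (n : ℝ) ^ (-M.β) • z) - f x) :=
  finsum_jumps_eq_sum hn hF (g := fun z => f (x + (n : ℝ) ^ (-M.β) • z) - f x) (by simp)

lemma spaceGen_congr (hn : 1 ≤ n) {k : Fin k₀} {x : EuclideanSpace ℝ (Fin d)}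
    (hx : x ∈ M.hatX xs n) {f g : EuclideanSpace ℝ (Fin d) → ℝ} (h : EqOn f g (M.hatX xs n)) :
    M.spaceGen xs n k f x = M.spaceGen xs n k g x := by
  refine finsum_mem_congr rfl fun z hz => ?_
  rw [h hx, h (add_mem_hatX hn hz)]

section

variable {m₀ C₀ : ℝ} {N₀ : ℕ} (hM : M.Structural xs m₀ N₀ C₀)
include hM

lemma Structural.avgGen_eq (hn : 1 ≤ n) {x : EuclideanSpace ℝ (Fin d)} (hx : x ∈ M.hatX xs n)
    (f : EuclideanSpace ℝ (Fin d) → ℝ) :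
    M.avgGen xs n f x = ∑ l, M.π l * M.spaceGen xs n l f x := by
  classical
  have hX := (mem_hatX_iff hn).1 hx
  choose F hF _ using fun k => hM.exists_finset hn k hX
  have hFs : ∀ l, M.jumps n l (M.unscale xs n x) ⊆ (Finset.univ.biUnion F : Finset _) := by
    intro l z hz
    rw [← hF l] at hz
    simp only [Finset.coe_biUnion, mem_iUnion]
    exact ⟨l, by simp, hz⟩
  have h1 : M.avgGen xs n f x = ∑ z ∈ Finset.univ.biUnion F, M.avgRate n (M.unscale xs n x) z *
      (f (x + (n : ℝ) ^ (-M.β) • z) - f x) := by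
    refine finsum_mem_eq_sum_of_inter_support_eq _ ?_
    ext z
    simp only [mem_inter_iff, Function.mem_support]
    refine ⟨fun h => ⟨?_, h.2⟩, fun h => ⟨?_, h.2⟩⟩
    · by_contra hz
      refine h.2 ?_
      by_cases hz0 : z = 0
      · simp [hz0]
      · have : M.avgRate n (M.unscale xs n x) z = 0 :=
          Finset.sum_eq_zero fun l _ => by
            rw [r_eq_zero hn hz0 fun hl => hz (hFs l hl), mul_zero]
        rw [this, zero_mul]
    · obtain ⟨l, _, hl⟩ := Finset.mem_biUnion.1 (Finset.mem_coe.1 h.1)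
      have hl' : z ∈ M.jumps n l (M.unscale xs n x) := by
        rw [← hF l]
        exact hl
      simp only [allJumps, mem_iUnion]
      exact ⟨_, hX, l, hl'⟩
  rw [h1]
  simp only [spaceGen_eq_sum hn (hFs _), avgRate, Finset.sum_mul, Finset.mul_sum]
  rw [Finset.sum_comm]
  simp only [mul_assoc]

variable {v : EuclideanSpace ℝ (Fin d) → ℝ} {ε₀ C : ℝ}

lemma Structural.abs_increment_le (hn : 1 ≤ n) (hC : 0 ≤ C) (hv0 : ∀ x, 0 ≤ v x)
    (hv1 : ∀ x y : EuclideanSpace ℝ (Fin d), 0 < ‖y‖ → ‖y‖ < ε₀ →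
      (1 + ‖x‖) * |v (x + y) - v x| ≤ C * ‖y‖ * (1 + v x))
    (hsmall : (n : ℝ) ^ (-M.β) * m₀ < ε₀) {l : Fin k₀} {y x z : EuclideanSpace ℝ (Fin d)}
    (hz : z ∈ M.jumps n l y) :
    |v (x + (n : ℝ) ^ (-M.β) • z) - v x| ≤
      C * ((n : ℝ) ^ (-M.β) * m₀) * (1 + v x) / (1 + ‖x‖) := by
  have hpos := scale_pow_pos hn (-M.β)
  have hz0 : 0 < ‖z‖ := norm_pos_iff.2 (ne_zero_of_mem_jumps hn hz)
  have hnorm : ‖(n : ℝ) ^ (-M.β) • z‖ = (n : ℝ) ^ (-M.β) * ‖z‖ := by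
    rw [norm_smul, Real.norm_of_nonneg hpos.le]
  have hle : ‖(n : ℝ) ^ (-M.β) • z‖ ≤ (n : ℝ) ^ (-M.β) * m₀ := by
    rw [hnorm]
    exact mul_le_mul_of_nonneg_left (hM.norm_le hn hz) hpos.le
  have h := hv1 x ((n : ℝ) ^ (-M.β) • z) (by rw [hnorm]; positivity) (hle.trans_lt hsmall)
  rw [le_div_iff₀ (by positivity), mul_comm]
  refine h.trans ?_
  have := hv0 x
  gcongr

lemma Structural.abs_spaceGen_le (hn : 1 ≤ n) (hC : 0 ≤ C) (hm₀ : 0 ≤ m₀) (hv0 : ∀ x, 0 ≤ v x)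
    (hv1 : ∀ x y : EuclideanSpace ℝ (Fin d), 0 < ‖y‖ → ‖y‖ < ε₀ →
      (1 + ‖x‖) * |v (x + y) - v x| ≤ C * ‖y‖ * (1 + v x))
    (hsmall : (n : ℝ) ^ (-M.β) * m₀ < ε₀) {x : EuclideanSpace ℝ (Fin d)} (hx : x ∈ M.hatX xs n)
    (l : Fin k₀) {b : ℝ} (hb0 : 0 ≤ b)
    (hb : ∀ z, z ≠ 0 → M.r n l (M.unscale xs n x) (M.unscale xs n x + z) ≤ b) :
    |M.spaceGen xs n l v x| ≤
      N₀ * (b * (C * ((n : ℝ) ^ (-M.β) * m₀) * (1 + v x) / (1 + ‖x‖))) := by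
  obtain ⟨F, hF, hcard⟩ := hM.exists_finset hn l ((mem_hatX_iff hn).1 hx)
  rw [spaceGen_eq_sum hn hF.ge]
  have hpos := scale_pow_pos hn (-M.β)
  have hv := hv0 x
  refine (Finset.abs_sum_le_sum_abs _ _).trans ?_
  refine (Finset.sum_le_card_nsmul F _ (b * (C * ((n : ℝ) ^ (-M.β) * m₀) * (1 + v x) / (1 + ‖x‖)))
    fun z hz => ?_).trans ?_
  · have hz' : z ∈ M.jumps n l (M.unscale xs n x) := by
      rw [← hF]
      exact hz
    have hz0 := ne_zero_of_mem_jumps hn hz'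
    rw [abs_mul, abs_of_nonneg (r_nonneg hn l _ hz0)]
    exact mul_le_mul (hb z hz0) (hM.abs_increment_le hn hC hv0 hv1 hsmall hz') (abs_nonneg _) hb0
  · rw [nsmul_eq_mul]
    gcongr

lemma Structural.abs_second_increment_le (hn : 1 ≤ n) (hC : 0 ≤ C) (hm₀ : 0 ≤ m₀)
    (hv0 : ∀ x, 0 ≤ v x)
    (hv2 : ∀ x y z : EuclideanSpace ℝ (Fin d), 0 < ‖y‖ → ‖y‖ < ε₀ → 0 < ‖z‖ → ‖z‖ < ε₀ →
      (1 + ‖x‖ ^ 2) * |v (x + y + z) - v (x + y) - v (x + z) + v x| ≤ C * ‖y‖ * ‖z‖ * (1 + v x))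
    (hsmall : (n : ℝ) ^ (-M.β) * m₀ < ε₀) {k l : Fin k₀} {y y' x z w : EuclideanSpace ℝ (Fin d)}
    (hz : z ∈ M.jumps n k y) (hw : w ∈ M.jumps n l y') :
    |v (x + (n : ℝ) ^ (-M.β) • z + (n : ℝ) ^ (-M.β) • w) - v (x + (n : ℝ) ^ (-M.β) • z) -
      v (x + (n : ℝ) ^ (-M.β) • w) + v x| ≤
      C * ((n : ℝ) ^ (-M.β) * m₀) * ((n : ℝ) ^ (-M.β) * m₀) * (1 + v x) / (1 + ‖x‖ ^ 2) := by
  have hpos := scale_pow_pos hn (-M.β)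
  have hnorm : ∀ z, ‖(n : ℝ) ^ (-M.β) • (z : EuclideanSpace ℝ (Fin d))‖ =
      (n : ℝ) ^ (-M.β) * ‖z‖ := fun z => by
    rw [norm_smul, Real.norm_of_nonneg hpos.le]
  have hbd : ∀ (k : Fin k₀) (y z : EuclideanSpace ℝ (Fin d)), z ∈ M.jumps n k y →
      0 < ‖(n : ℝ) ^ (-M.β) • z‖ ∧ ‖(n : ℝ) ^ (-M.β) • z‖ ≤ (n : ℝ) ^ (-M.β) * m₀ := by
    intro k y z hz
    have hz0 : 0 < ‖z‖ := norm_pos_iff.2 (ne_zero_of_mem_jumps hn hz)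
    rw [hnorm]
    exact ⟨by positivity, mul_le_mul_of_nonneg_left (hM.norm_le hn hz) hpos.le⟩
  obtain ⟨h1, h2⟩ := hbd k y z hz
  obtain ⟨h3, h4⟩ := hbd l y' w hw
  have h := hv2 x _ _ h1 (h2.trans_lt hsmall) h3 (h4.trans_lt hsmall)
  rw [le_div_iff₀ (by positivity), mul_comm]
  refine h.trans ?_
  have := hv0 x
  gcongr

/-- Discrete product rule: the difference of the generators at two points is the rate at the shifted
point times a second difference of `v`, plus an increment of the rate times a first difference of
`v`. The factor `2 N₀` counts the jumps available at the two points together. -/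
lemma Structural.abs_spaceGen_sub_le (hn : 1 ≤ n) (hC : 0 ≤ C) (hm₀ : 0 ≤ m₀) (hC₀ : 0 ≤ C₀)
    (hv0 : ∀ x, 0 ≤ v x)
    (hv1 : ∀ x y : EuclideanSpace ℝ (Fin d), 0 < ‖y‖ → ‖y‖ < ε₀ →
      (1 + ‖x‖) * |v (x + y) - v x| ≤ C * ‖y‖ * (1 + v x))
    (hv2 : ∀ x y z : EuclideanSpace ℝ (Fin d), 0 < ‖y‖ → ‖y‖ < ε₀ → 0 < ‖z‖ → ‖z‖ < ε₀ →
      (1 + ‖x‖ ^ 2) * |v (x + y + z) - v (x + y) - v (x + z) + v x| ≤ C * ‖y‖ * ‖z‖ * (1 + v x))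
    (hsmall : (n : ℝ) ^ (-M.β) * m₀ < ε₀) {x z : EuclideanSpace ℝ (Fin d)}
    {k : Fin k₀} (hz : z ∈ M.jumps n k (M.unscale xs n x)) (l : Fin k₀) {b : ℝ} (hb0 : 0 ≤ b)
    (hb : ∀ w, w ≠ 0 → M.r n l (M.unscale xs n x + z) (M.unscale xs n x + z + w) ≤ b) :
    |M.spaceGen xs n l v (x + (n : ℝ) ^ (-M.β) • z) - M.spaceGen xs n l v x| ≤
      2 * N₀ * (b * (C * ((n : ℝ) ^ (-M.β) * m₀) * ((n : ℝ) ^ (-M.β) * m₀) * (1 + v x) /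
          (1 + ‖x‖ ^ 2)) +
        C₀ * ((n : ℝ) ^ (M.α / 2) + m₀) *
          (C * ((n : ℝ) ^ (-M.β) * m₀) * (1 + v x) / (1 + ‖x‖))) := by
  classical
  obtain ⟨hX, hXz⟩ := mem_of_mem_jumps hn hz
  obtain ⟨F, hF, hFcard⟩ := hM.exists_finset hn l hX
  obtain ⟨F', hF', hFcard'⟩ := hM.exists_finset hn l hXz
  have hpos := scale_pow_pos hn (-M.β)
  have hposα := scale_pow_pos hn (M.α / 2)
  have hv := hv0 x
  rw [spaceGen_eq_sum hn (F := F ∪ F') (by rw [unscale_add_smul hn, ← hF']; simp),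
    spaceGen_eq_sum hn (F := F ∪ F') (by rw [← hF]; simp), ← Finset.sum_sub_distrib,
    unscale_add_smul hn]
  refine (Finset.abs_sum_le_sum_abs _ _).trans ?_
  refine (Finset.sum_le_card_nsmul _ _ (b * (C * ((n : ℝ) ^ (-M.β) * m₀) *
    ((n : ℝ) ^ (-M.β) * m₀) * (1 + v x) / (1 + ‖x‖ ^ 2)) + C₀ * ((n : ℝ) ^ (M.α / 2) + m₀) *
          (C * ((n : ℝ) ^ (-M.β) * m₀) * (1 + v x) / (1 + ‖x‖))) fun w hw => ?_).trans ?_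
  · obtain ⟨y', hw'⟩ : ∃ y', w ∈ M.jumps n l y' := by
      rcases Finset.mem_union.1 hw with h | h
      · exact ⟨_, by rw [← hF]; exact h⟩
      · exact ⟨_, by rw [← hF']; exact h⟩
    have hw0 := ne_zero_of_mem_jumps hn hw'
    rw [show ∀ r r' a b c e : ℝ, r' * (a - b) - r * (c - e) =
      r' * (a - b - c + e) + (r' - r) * (c - e) from fun _ _ _ _ _ _ => by ring]
    refine (abs_add_le _ _).trans (add_le_add ?_ ?_)
    · rw [abs_mul, abs_of_nonneg (r_nonneg hn l _ hw0)]
      exact mul_le_mul (hb w hw0) (hM.abs_second_increment_le hn hC hm₀ hv0 hv2 hsmall hz hw')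
        (abs_nonneg _) hb0
    · rw [abs_mul]
      refine mul_le_mul ?_ (hM.abs_increment_le hn hC hv0 hv1 hsmall hw') (abs_nonneg _)
        (by positivity)
      refine (hM.incr_growth n hn l _ hXz _ hX w hw0).trans ?_
      rw [add_sub_cancel_left]
      have := hM.norm_le hn hz
      gcongr
  · rw [nsmul_eq_mul]
    have : ((F ∪ F').card : ℝ) ≤ 2 * N₀ := by
      have := Finset.card_union_le F F'
      exact_mod_cast (by omega : (F ∪ F').card ≤ 2 * N₀)
    gcongr

end

end ModulatedModel

/-- Local boundedness of a function whose increments are controlled by its own size. -/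
lemma one_add_le_pow_of_increment {E : Type*} [NormedAddCommGroup E] [NormedSpace ℝ E] {v : E → ℝ}
    {ε₀ C : ℝ} (hC : 0 ≤ C) (hε₀ : 0 ≤ ε₀) (hv0 : ∀ x, 0 ≤ v x)
    (hv1 : ∀ x y : E, 0 < ‖y‖ → ‖y‖ < ε₀ → (1 + ‖x‖) * |v (x + y) - v x| ≤ C * ‖y‖ * (1 + v x))
    (m : ℕ) {x : E} (hx : ‖x‖ < m * ε₀) : 1 + v x ≤ (1 + C * ε₀) ^ m * (1 + v 0) := by
  have hstep : ∀ x y : E, ‖y‖ < ε₀ → 1 + v (x + y) ≤ (1 + C * ε₀) * (1 + v x) := by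
    intro x y hy
    have hv := hv0 x
    have hCε := mul_nonneg hC hε₀
    rcases (norm_nonneg y).eq_or_lt with h | h
    · rw [norm_eq_zero.1 h.symm, add_zero]
      nlinarith
    · have h1 := hv1 x y h hy
      have h2 : |v (x + y) - v x| ≤ (1 + ‖x‖) * |v (x + y) - v x| :=
        le_mul_of_one_le_left (abs_nonneg _) (by linarith [norm_nonneg x])
      have h3 : C * ‖y‖ * (1 + v x) ≤ C * ε₀ * (1 + v x) := by gcongr
      linarith [le_abs_self (v (x + y) - v x)]
  rcases Nat.eq_zero_or_pos m with rfl | hm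
  · simp at hx
    exact absurd hx (not_lt.2 (norm_nonneg x))
  have hm' : (0 : ℝ) < m := by exact_mod_cast hm
  -- The segment from `0` to `x` is cut into `m` steps shorter than `ε₀`; each multiplies `1 + v` by
  -- at most `1 + C ε₀`.
  have hy : ‖(m : ℝ)⁻¹ • x‖ < ε₀ := by
    rw [norm_smul, norm_inv, Real.norm_of_nonneg hm'.le, inv_mul_lt_iff₀ hm']
    exact hx
  have hiter : ∀ j : ℕ, 1 + v ((j : ℝ) • (m : ℝ)⁻¹ • x) ≤ (1 + C * ε₀) ^ j * (1 + v 0) := by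
    intro j
    induction j with
    | zero => simp
    | succ j ih =>
      rw [Nat.cast_succ, add_smul, one_smul, pow_succ', mul_assoc]
      refine (hstep _ _ hy).trans (mul_le_mul_of_nonneg_left ih ?_)
      have := mul_nonneg hC hε₀
      linarith
  have := hiter m
  rwa [smul_smul, mul_inv_cancel₀ hm'.ne', one_smul] at this

/-- Read `a = n^(-α/2)`, `u = n^(α/2)`, `h = n^(-β)`, `s = ‖x‖`, `v = 1 + V`, with `c (1 + m) G` the
bound on the rates; `ρ` below is then `ratio`. The second-difference term is of order `ρ² (1 + s)² /
(1 + s²) ≤ 6 ρ`, using `ρ ≤ 3`. In the other term one factor `a` cancels `u`, leaving `ρ`. -/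
lemma averaging_error_arith {a u h G m c v s : ℝ} (hau : a * u = 1) (ha : 0 < a) (hh : 0 < h)
    (hG : 0 ≤ G) (hm : 0 ≤ m) (hc : 0 ≤ c) (hv : 0 ≤ v) (hs : 0 ≤ s) (hu1 : 1 ≤ u)
    (hr : a * G * h / (1 + s) ≤ 3) :
    a * a * (c * (1 + m) * G) * (c * (1 + m) * G * ((h * m) * (h * m) * v / (1 + s ^ 2)) +
      c * (u + m) * ((h * m) * v / (1 + s))) ≤
    (c * (1 + m)) ^ 2 * (6 * m ^ 2 + m) * (a * G * h / (1 + s) * v) := by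
  set ρ := a * G * h / (1 + s) with hρ
  have hρ0 : 0 ≤ ρ := by positivity
  have hH : a * G * h = ρ * (1 + s) := by
    rw [hρ]
    field_simp
  have e1 : a * a * (c * (1 + m) * G) * (c * (1 + m) * G * ((h * m) * (h * m) * v / (1 + s ^ 2))) =
      (c * (1 + m)) ^ 2 * m ^ 2 * v * ((a * G * h) ^ 2 / (1 + s ^ 2)) := by ring
  have h1 : (a * G * h) ^ 2 / (1 + s ^ 2) ≤ 6 * ρ := by
    rw [hH, div_le_iff₀ (by positivity)]
    have h2 : (1 + s) ^ 2 ≤ 2 * (1 + s ^ 2) := by nlinarith [sq_nonneg (1 - s)]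
    calc (ρ * (1 + s)) ^ 2 = ρ * (ρ * (1 + s) ^ 2) := by ring
      _ ≤ ρ * (3 * (2 * (1 + s ^ 2))) := by gcongr
      _ = 6 * ρ * (1 + s ^ 2) := by ring
  have h3 : a * a * (c * (1 + m) * G) * (c * (u + m) * ((h * m) * v / (1 + s))) ≤
      a * a * (c * (1 + m) * G) * (c * ((1 + m) * u) * ((h * m) * v / (1 + s))) := by
    gcongr
    nlinarith
  have e2 : a * a * (c * (1 + m) * G) * (c * ((1 + m) * u) * ((h * m) * v / (1 + s))) =
      (c * (1 + m)) ^ 2 * m * v * ρ := by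
    rw [hρ]
    linear_combination (a * (c * (1 + m) * G) * (c * (1 + m) * ((h * m) * v / (1 + s)))) * hau
  rw [mul_add, e1]
  have h4 := mul_le_mul_of_nonneg_left h1 (show 0 ≤ (c * (1 + m)) ^ 2 * m ^ 2 * v by positivity)
  nlinarith

/-! ### The corrector and the averaging error. -/

namespace ModulatedModel

variable {d k₀ : ℕ} (M : ModulatedModel d k₀) (xs : ℕ → EuclideanSpace ℝ (Fin d))

/-- The size of the scaled rates relative to the distance from the origin. -/
noncomputable def ratio (n : ℕ) (x : EuclideanSpace ℝ (Fin d)) : ℝ :=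
  (n : ℝ) ^ (-(M.α / 2)) * ((n : ℝ) ^ (M.α / 2) + (n : ℝ) ^ M.β * ‖x‖ + n) * (n : ℝ) ^ (-M.β) /
    (1 + ‖x‖)

/-- The averaged Lyapunov function, corrected by the solution of the Poisson equation. -/
noncomputable def corrector (T : Fin k₀ → Fin k₀ → ℝ) (n : ℕ)
    (v : EuclideanSpace ℝ (Fin d) → ℝ) (p : EuclideanSpace ℝ (Fin d) × Fin k₀) : ℝ :=
  v p.1 + (n : ℝ) ^ (-M.α) * ∑ l, T p.2 l * M.spaceGen xs n l v p.1

variable {M xs} {n : ℕ}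

lemma exponent_nonpos : 1 - M.β - M.α / 2 ≤ 0 := by
  have : 1 - M.α / 2 ≤ M.β := le_max_right _ _
  linarith

lemma ratio_le (hn : 1 ≤ n) (x : EuclideanSpace ℝ (Fin d)) :
    M.ratio n x ≤ (n : ℝ) ^ (-M.β) + (n : ℝ) ^ (-(M.α / 2)) +
      (n : ℝ) ^ (1 - M.β - M.α / 2) / (1 + ‖x‖) := by
  have hn' : (0 : ℝ) < n := by exact_mod_cast hn
  have e1 : (n : ℝ) ^ (-(M.α / 2)) * (n : ℝ) ^ (M.α / 2) = 1 := by
    rw [← Real.rpow_add hn', neg_add_cancel, Real.rpow_zero]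
  have e2 : (n : ℝ) ^ M.β * (n : ℝ) ^ (-M.β) = 1 := by
    rw [← Real.rpow_add hn', add_neg_cancel, Real.rpow_zero]
  have e3 : (n : ℝ) ^ (1 - M.β - M.α / 2) =
      (n : ℝ) ^ (-(M.α / 2)) * n * (n : ℝ) ^ (-M.β) := by
    nth_rewrite 3 [← Real.rpow_one (n : ℝ)]
    rw [← Real.rpow_add hn', ← Real.rpow_add hn']
    congr 1
    ring
  have h1 := scale_pow_pos hn (-M.β)
  have h2 := scale_pow_pos hn (-(M.α / 2))
  have hx := norm_nonneg x
  have e4 : M.ratio n x = ((n : ℝ) ^ (-M.β) + (n : ℝ) ^ (-(M.α / 2)) * ‖x‖) / (1 + ‖x‖) +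
      (n : ℝ) ^ (1 - M.β - M.α / 2) / (1 + ‖x‖) := by
    rw [← add_div, ratio, e3]
    congr 1
    linear_combination (n : ℝ) ^ (-M.β) * e1 + (n : ℝ) ^ (-(M.α / 2)) * ‖x‖ * e2
  rw [e4]
  refine add_le_add ((div_le_iff₀ (by positivity)).2 ?_) le_rfl
  nlinarith [mul_nonneg h1.le hx]

lemma ratio_le_three (hn : 1 ≤ n) (x : EuclideanSpace ℝ (Fin d)) : M.ratio n x ≤ 3 := by
  have hn' : (1 : ℝ) ≤ n := by exact_mod_cast hn
  have hβ : 0 ≤ M.β := le_trans (by norm_num) (le_max_left _ _)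
  have h1 : (n : ℝ) ^ (-M.β) ≤ 1 := Real.rpow_le_one_of_one_le_of_nonpos hn' (by linarith)
  have h2 : (n : ℝ) ^ (-(M.α / 2)) ≤ 1 :=
    Real.rpow_le_one_of_one_le_of_nonpos hn' (by linarith [M.α_pos])
  have h3 : (n : ℝ) ^ (1 - M.β - M.α / 2) ≤ 1 :=
    Real.rpow_le_one_of_one_le_of_nonpos hn' exponent_nonpos
  have h4 : (n : ℝ) ^ (1 - M.β - M.α / 2) / (1 + ‖x‖) ≤ 1 := by
    rw [div_le_one (by positivity)]
    linarith [norm_nonneg x]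
  linarith [ratio_le (M := M) hn x]

lemma tendsto_natCast_rpow {a : ℝ} (ha : a < 0) :
    Tendsto (fun n : ℕ => (n : ℝ) ^ a) atTop (𝓝 0) := by
  have := (tendsto_rpow_neg_atTop (show 0 < -a by linarith)).comp tendsto_natCast_atTop_atTop
  simpa [Function.comp_def] using this

/-- The averaging error is negligible relative to the Lyapunov functions. -/
lemma exists_ratio_mul_le {V : ℕ → EuclideanSpace ℝ (Fin d) → ℝ} {ε₀ C : ℝ} (hε₀ : 0 < ε₀)
    (hC : 0 ≤ C) (hV0 : ∀ n, 1 ≤ n → ∀ x, 0 ≤ V n x)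
    (hV1 : ∀ n, 1 ≤ n → ∀ x y : EuclideanSpace ℝ (Fin d), 0 < ‖y‖ → ‖y‖ < ε₀ →
      (1 + ‖x‖) * |V n (x + y) - V n x| ≤ C * ‖y‖ * (1 + V n x))
    (hA : M.α ≤ 1 → ∃ A : ℝ, ∀ n, 1 ≤ n → V n 0 ≤ A) {δ : ℝ} (hδ : 0 < δ) :
    ∃ B n₁, 0 ≤ B ∧ ∀ n, 1 ≤ n → n₁ ≤ n → ∀ x,
      M.ratio n x * (1 + V n x) ≤ δ * (1 + V n x) + B := by
  have hβ : 0 < M.β := lt_of_lt_of_le (by norm_num) (le_max_left _ _)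
  have hlim : Tendsto (fun n : ℕ => (n : ℝ) ^ (-M.β) + (n : ℝ) ^ (-(M.α / 2))) atTop (𝓝 0) := by
    simpa using (tendsto_natCast_rpow (a := -M.β) (by linarith)).add
      (tendsto_natCast_rpow (a := -(M.α / 2)) (by linarith [M.α_pos]))
  obtain ⟨N, hN⟩ := eventually_atTop.1 (hlim.eventually (eventually_le_nhds (half_pos hδ)))
  rcases le_or_gt M.α 1 with hα | hα
  · obtain ⟨A, hA⟩ := hA hα
    -- Beyond the radius `m ε₀ > 2 / δ` the term `1 / (1 + ‖x‖)` is at most `δ / 2`; inside it, `m`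
    -- steps from the origin bound `V`.
    obtain ⟨m, hm⟩ := exists_nat_gt (2 / δ / ε₀)
    rw [div_lt_iff₀ hε₀] at hm
    have hA0 : 0 ≤ A := (hV0 1 le_rfl 0).trans (hA 1 le_rfl)
    refine ⟨(1 + C * ε₀) ^ m * (1 + A), N, by positivity, fun n hn hnN x => ?_⟩
    have hv := hV0 n hn x
    have hr := ratio_le (M := M) hn x
    have h3 : (n : ℝ) ^ (1 - M.β - M.α / 2) ≤ 1 :=
      Real.rpow_le_one_of_one_le_of_nonpos (by exact_mod_cast hn) exponent_nonpos
    have h4 := hN n hnN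
    have hx0 := norm_nonneg x
    have h5 : (n : ℝ) ^ (1 - M.β - M.α / 2) / (1 + ‖x‖) ≤ 1 / (1 + ‖x‖) := by gcongr
    have h6 : M.ratio n x * (1 + V n x) ≤ (δ / 2 + 1 / (1 + ‖x‖)) * (1 + V n x) := by
      refine mul_le_mul_of_nonneg_right ?_ (by linarith)
      linarith
    refine h6.trans ?_
    have hB : 0 ≤ (1 + C * ε₀) ^ m * (1 + A) := by positivity
    by_cases hx : ‖x‖ < m * ε₀
    · have h7 := one_add_le_pow_of_increment hC hε₀.le (hV0 n hn) (hV1 n hn) m hx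
      have h8 : (1 + C * ε₀) ^ m * (1 + V n 0) ≤ (1 + C * ε₀) ^ m * (1 + A) := by
        have := hA n hn
        gcongr
      have h9 : 1 / (1 + ‖x‖) * (1 + V n x) ≤ 1 + V n x := by
        refine mul_le_of_le_one_left (by linarith) ?_
        rw [div_le_one (by positivity)]
        linarith
      nlinarith
    · push Not at hx
      have h7 : 1 / (1 + ‖x‖) ≤ δ / 2 := by
        rw [div_le_iff₀ (by positivity)]
        have : 2 / δ ≤ ‖x‖ := by linarith
        rw [div_le_iff₀ hδ] at this
        linarith
      have : (δ / 2 + 1 / (1 + ‖x‖)) * (1 + V n x) ≤ δ * (1 + V n x) := by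
        refine mul_le_mul_of_nonneg_right ?_ (by linarith)
        linarith
      linarith
  · have hexp : 1 - M.β - M.α / 2 < 0 := by
      have : 1 / 2 ≤ M.β := le_max_left _ _
      linarith
    obtain ⟨N', hN'⟩ := eventually_atTop.1
      ((tendsto_natCast_rpow hexp).eventually (eventually_le_nhds (half_pos hδ)))
    refine ⟨0, max N N', le_rfl, fun n hn hnN x => ?_⟩
    have hv := hV0 n hn x
    have hr := ratio_le (M := M) hn x
    have h4 := hN n ((le_max_left _ _).trans hnN)
    have h5 := hN' n ((le_max_right _ _).trans hnN)
    have h6 : (n : ℝ) ^ (1 - M.β - M.α / 2) / (1 + ‖x‖) ≤ (n : ℝ) ^ (1 - M.β - M.α / 2) :=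
      div_le_self (scale_pow_pos hn _).le (by linarith [norm_nonneg x])
    rw [add_zero]
    refine mul_le_mul_of_nonneg_right ?_ (by linarith)
    linarith

section

variable {m₀ C₀ : ℝ} {N₀ : ℕ} (hM : M.Structural xs m₀ N₀ C₀)
include hM

/-- The shift `u` allows the same bound at a point and at its neighbours after one jump; it costs
the factor `1 + m₀`, as `n ≥ 1`. -/
lemma Structural.rate_le (hn : 1 ≤ n) (hm₀ : 0 ≤ m₀) (hC₀ : 0 ≤ C₀)
    {x : EuclideanSpace ℝ (Fin d)} {u : EuclideanSpace ℝ (Fin d)} (hu : ‖u‖ ≤ m₀)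
    (hx : M.unscale xs n x + u ∈ M.X n) (l : Fin k₀) {z : EuclideanSpace ℝ (Fin d)} (hz : z ≠ 0) :
    M.r n l (M.unscale xs n x + u) (M.unscale xs n x + u + z) ≤
      C₀ * (1 + m₀) * ((n : ℝ) ^ (M.α / 2) + (n : ℝ) ^ M.β * ‖x‖ + n) := by
  refine (hM.affine_growth n hn l _ hx z hz).trans ?_
  have hβ := scale_pow_pos hn M.β
  have hα := scale_pow_pos hn (M.α / 2)
  have h1 : ‖M.unscale xs n x + u - xs n‖ ≤ (n : ℝ) ^ M.β * ‖x‖ + m₀ := by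
    have : M.unscale xs n x + u - xs n = (n : ℝ) ^ M.β • x + u := by
      rw [unscale]
      abel
    rw [this]
    refine (norm_add_le _ _).trans (add_le_add (le_of_eq ?_) hu)
    rw [norm_smul, Real.norm_of_nonneg hβ.le]
  have hn' : (1 : ℝ) ≤ n := by exact_mod_cast hn
  rw [mul_assoc]
  refine mul_le_mul_of_nonneg_left ?_ hC₀
  have h2 : 0 ≤ m₀ * ((n : ℝ) ^ (M.α / 2) + (n : ℝ) ^ M.β * ‖x‖) := by positivity
  have h3 : m₀ ≤ m₀ * n := le_mul_of_one_le_right hm₀ hn'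
  linarith

lemma Structural.rate_le' (hn : 1 ≤ n) (hm₀ : 0 ≤ m₀) (hC₀ : 0 ≤ C₀)
    {x : EuclideanSpace ℝ (Fin d)} (hx : x ∈ M.hatX xs n) (l : Fin k₀)
    {z : EuclideanSpace ℝ (Fin d)} (hz : z ≠ 0) :
    M.r n l (M.unscale xs n x) (M.unscale xs n x + z) ≤
      C₀ * (1 + m₀) * ((n : ℝ) ^ (M.α / 2) + (n : ℝ) ^ M.β * ‖x‖ + n) := by
  have := hM.rate_le hn hm₀ hC₀ (u := 0) (x := x) (by simpa using hm₀)
    (by simpa using (mem_hatX_iff hn).1 hx) l hz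
  simpa using this

lemma Structural.jointGen_corrector (hn : 1 ≤ n) {T : Fin k₀ → Fin k₀ → ℝ}
    (hT : ∀ k l, ∑ m, M.Q k m * T m l = M.π l - if k = l then 1 else 0)
    (v : EuclideanSpace ℝ (Fin d) → ℝ) {x : EuclideanSpace ℝ (Fin d)} (hx : x ∈ M.hatX xs n)
    (k : Fin k₀) :
    M.jointGen xs n (M.corrector xs T n v) x k = M.avgGen xs n v x +
      M.spaceGen xs n k (fun y => (n : ℝ) ^ (-M.α) * ∑ l, T k l * M.spaceGen xs n l v y) x := by
  have hn' : (0 : ℝ) < n := by exact_mod_cast hn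
  obtain ⟨F, hF, -⟩ := hM.exists_finset hn k ((mem_hatX_iff hn).1 hx)
  have h0 : M.jointGen xs n (M.corrector xs T n v) x k =
      M.spaceGen xs n k (fun y => M.corrector xs T n v (y, k)) x +
      ∑ l, (n : ℝ) ^ M.α * M.Q k l * (M.corrector xs T n v (x, l) - M.corrector xs T n v (x, k)) :=
    rfl
  have h1 : M.spaceGen xs n k (fun y => M.corrector xs T n v (y, k)) x = M.spaceGen xs n k v x +
      M.spaceGen xs n k (fun y => (n : ℝ) ^ (-M.α) * ∑ l, T k l * M.spaceGen xs n l v y) x := by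
    simp only [corrector]
    rw [spaceGen_eq_sum hn hF.ge, spaceGen_eq_sum hn hF.ge, spaceGen_eq_sum hn hF.ge,
      ← Finset.sum_add_distrib]
    exact Finset.sum_congr rfl fun z _ => by ring
  -- The regime-independent part of the corrector drops out, and so does the subtracted `T k` term
  -- because the rows of `Q` sum to zero. The Poisson equation evaluates the rest.
  have h2 : ∑ l, (n : ℝ) ^ M.α * M.Q k l *
      (M.corrector xs T n v (x, l) - M.corrector xs T n v (x, k)) =
      M.avgGen xs n v x - M.spaceGen xs n k v x := by
    have e1 : (n : ℝ) ^ M.α * (n : ℝ) ^ (-M.α) = 1 := by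
      rw [← Real.rpow_add hn', add_neg_cancel, Real.rpow_zero]
    have e2 : ∀ l, (n : ℝ) ^ M.α * M.Q k l *
        (M.corrector xs T n v (x, l) - M.corrector xs T n v (x, k)) =
        M.Q k l * (∑ m, T l m * M.spaceGen xs n m v x) -
          M.Q k l * (∑ m, T k m * M.spaceGen xs n m v x) := by
      intro l
      simp only [corrector]
      linear_combination (M.Q k l * (∑ m, T l m * M.spaceGen xs n m v x) -
          M.Q k l * (∑ m, T k m * M.spaceGen xs n m v x)) * e1
    rw [Finset.sum_congr rfl fun l _ => e2 l, Finset.sum_sub_distrib, ← Finset.sum_mul,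
      M.Q_rate.sum_row, zero_mul, sub_zero]
    simp only [Finset.mul_sum]
    rw [Finset.sum_comm]
    simp only [← mul_assoc, ← Finset.sum_mul, hT, sub_mul, Finset.sum_sub_distrib, ite_mul, one_mul,
      zero_mul, Finset.sum_ite_eq, Finset.mem_univ, if_true]
    rw [hM.avgGen_eq hn hx]
  rw [h0, h1, h2]
  ring

variable {v : EuclideanSpace ℝ (Fin d) → ℝ} {ε₀ C : ℝ} (T : Fin k₀ → Fin k₀ → ℝ)

/-- One application of the space generator costs only half of `n^(-α)`; the other half remains as
the decaying factor in front of `ratio`. -/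
lemma Structural.abs_correction_le (hn : 1 ≤ n) (hC : 0 ≤ C) (hm₀ : 0 ≤ m₀) (hC₀ : 0 ≤ C₀)
    (hv0 : ∀ x, 0 ≤ v x)
    (hv1 : ∀ x y : EuclideanSpace ℝ (Fin d), 0 < ‖y‖ → ‖y‖ < ε₀ →
      (1 + ‖x‖) * |v (x + y) - v x| ≤ C * ‖y‖ * (1 + v x))
    (hsmall : (n : ℝ) ^ (-M.β) * m₀ < ε₀) {x : EuclideanSpace ℝ (Fin d)} (hx : x ∈ M.hatX xs n)
    (k : Fin k₀) :
    |(n : ℝ) ^ (-M.α) * ∑ l, T k l * M.spaceGen xs n l v x| ≤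
      (∑ k, ∑ l, |T k l|) * N₀ * C₀ * (1 + m₀) * C * m₀ *
        ((n : ℝ) ^ (-(M.α / 2)) * M.ratio n x * (1 + v x)) := by
  have hn' : (0 : ℝ) < n := by exact_mod_cast hn
  have hα := scale_pow_pos hn (-M.α)
  have hα2 := scale_pow_pos hn (M.α / 2)
  have hβ := scale_pow_pos hn (-M.β)
  have hβ' := scale_pow_pos hn M.β
  have hv := hv0 x
  have e : (n : ℝ) ^ (-M.α) = (n : ℝ) ^ (-(M.α / 2)) * (n : ℝ) ^ (-(M.α / 2)) := by
    rw [← Real.rpow_add hn']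
    congr 1
    ring
  have hb := hM.abs_spaceGen_le hn hC hm₀ hv0 hv1 hsmall hx
    (b := C₀ * (1 + m₀) * ((n : ℝ) ^ (M.α / 2) + (n : ℝ) ^ M.β * ‖x‖ + n))
  have hTk : ∑ l, |T k l| ≤ ∑ k, ∑ l, |T k l| :=
    Finset.single_le_sum (f := fun k => ∑ l, |T k l|)
      (fun _ _ => Finset.sum_nonneg fun _ _ => abs_nonneg _) (Finset.mem_univ k)
  rw [abs_mul, abs_of_pos hα]
  have h1 : |∑ l, T k l * M.spaceGen xs n l v x| ≤ (∑ k, ∑ l, |T k l|) *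
      (N₀ * (C₀ * (1 + m₀) * ((n : ℝ) ^ (M.α / 2) + (n : ℝ) ^ M.β * ‖x‖ + n) *
        (C * ((n : ℝ) ^ (-M.β) * m₀) * (1 + v x) / (1 + ‖x‖)))) := by
    refine (Finset.abs_sum_le_sum_abs _ _).trans (le_trans ?_ (mul_le_mul_of_nonneg_right hTk
      (by positivity)))
    rw [Finset.sum_mul]
    refine Finset.sum_le_sum fun l _ => ?_
    rw [abs_mul]
    exact mul_le_mul_of_nonneg_left
      (hb l (by positivity) fun z hz => hM.rate_le' hn hm₀ hC₀ hx l hz) (abs_nonneg _)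
  refine (mul_le_mul_of_nonneg_left h1 hα.le).trans (le_of_eq ?_)
  rw [e, ratio]
  ring

/-- Both halves of `n^(-α)` are consumed: the outer generator contributes a further rate, so no
decaying power is left besides those in `ratio`. -/
lemma Structural.abs_averaging_error_le (hn : 1 ≤ n) (hC : 0 ≤ C) (hm₀ : 0 ≤ m₀) (hC₀ : 0 ≤ C₀)
    (hv0 : ∀ x, 0 ≤ v x)
    (hv1 : ∀ x y : EuclideanSpace ℝ (Fin d), 0 < ‖y‖ → ‖y‖ < ε₀ →
      (1 + ‖x‖) * |v (x + y) - v x| ≤ C * ‖y‖ * (1 + v x))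
    (hv2 : ∀ x y z : EuclideanSpace ℝ (Fin d), 0 < ‖y‖ → ‖y‖ < ε₀ → 0 < ‖z‖ → ‖z‖ < ε₀ →
      (1 + ‖x‖ ^ 2) * |v (x + y + z) - v (x + y) - v (x + z) + v x| ≤ C * ‖y‖ * ‖z‖ * (1 + v x))
    (hsmall : (n : ℝ) ^ (-M.β) * m₀ < ε₀) {x : EuclideanSpace ℝ (Fin d)} (hx : x ∈ M.hatX xs n)
    (k : Fin k₀) :
    |M.spaceGen xs n k (fun y => (n : ℝ) ^ (-M.α) * ∑ l, T k l * M.spaceGen xs n l v y) x| ≤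
      2 * N₀ ^ 2 * (∑ k, ∑ l, |T k l|) * C * ((C₀ * (1 + m₀)) ^ 2 * (6 * m₀ ^ 2 + m₀)) *
        (M.ratio n x * (1 + v x)) := by
  have hn' : (0 : ℝ) < n := by exact_mod_cast hn
  have hα := scale_pow_pos hn (-M.α)
  have hα2 := scale_pow_pos hn (M.α / 2)
  have hα2' := scale_pow_pos hn (-(M.α / 2))
  have hβ := scale_pow_pos hn (-M.β)
  have hβ' := scale_pow_pos hn M.β
  have hv := hv0 x
  have e : (n : ℝ) ^ (-M.α) = (n : ℝ) ^ (-(M.α / 2)) * (n : ℝ) ^ (-(M.α / 2)) := by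
    rw [← Real.rpow_add hn']
    congr 1
    ring
  have hau : (n : ℝ) ^ (-(M.α / 2)) * (n : ℝ) ^ (M.α / 2) = 1 := by
    rw [← Real.rpow_add hn', neg_add_cancel, Real.rpow_zero]
  have hu1 : 1 ≤ (n : ℝ) ^ (M.α / 2) :=
    Real.one_le_rpow (by exact_mod_cast hn) (by linarith [M.α_pos])
  have hTk : ∑ l, |T k l| ≤ ∑ k, ∑ l, |T k l| :=
    Finset.single_le_sum (f := fun k => ∑ l, |T k l|)
      (fun _ _ => Finset.sum_nonneg fun _ _ => abs_nonneg _) (Finset.mem_univ k)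
  have hX := (mem_hatX_iff hn).1 hx
  set τ := ∑ k, ∑ l, |T k l| with hτ
  have hτ0 : 0 ≤ τ := Finset.sum_nonneg fun _ _ => Finset.sum_nonneg fun _ _ => abs_nonneg _
  set G := (n : ℝ) ^ (M.α / 2) + (n : ℝ) ^ M.β * ‖x‖ + n with hG
  have hG0 : 0 ≤ G := by positivity
  set b := C₀ * (1 + m₀) * G with hb
  have hb0 : 0 ≤ b := by positivity
  set D := 2 * N₀ * (b * (C * ((n : ℝ) ^ (-M.β) * m₀) * ((n : ℝ) ^ (-M.β) * m₀) * (1 + v x) /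
          (1 + ‖x‖ ^ 2)) + C₀ * ((n : ℝ) ^ (M.α / 2) + m₀) *
          (C * ((n : ℝ) ^ (-M.β) * m₀) * (1 + v x) / (1 + ‖x‖))) with hD
  have hD0 : 0 ≤ D := by positivity
  obtain ⟨F, hF, hcard⟩ := hM.exists_finset hn k hX
  rw [spaceGen_eq_sum hn hF.ge]
  have hterm : ∀ z ∈ F, |M.r n k (M.unscale xs n x) (M.unscale xs n x + z) *
      ((n : ℝ) ^ (-M.α) * ∑ l, T k l * M.spaceGen xs n l v (x + (n : ℝ) ^ (-M.β) • z) -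
        (n : ℝ) ^ (-M.α) * ∑ l, T k l * M.spaceGen xs n l v x)| ≤
      b * ((n : ℝ) ^ (-M.α) * (τ * D)) := by
    intro z hz
    have hz' : z ∈ M.jumps n k (M.unscale xs n x) := by
      rw [← hF]
      exact hz
    have hz0 := ne_zero_of_mem_jumps hn hz'
    rw [abs_mul, abs_of_nonneg (r_nonneg hn k _ hz0), ← mul_sub, ← Finset.sum_sub_distrib, abs_mul,
      abs_of_pos hα]
    refine mul_le_mul (hM.rate_le' hn hm₀ hC₀ hx k hz0) ?_ (by positivity) hb0
    refine mul_le_mul_of_nonneg_left ?_ hα.le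
    refine (Finset.abs_sum_le_sum_abs _ _).trans (le_trans ?_ (mul_le_mul_of_nonneg_right hTk hD0))
    rw [Finset.sum_mul]
    refine Finset.sum_le_sum fun l _ => ?_
    rw [← mul_sub, abs_mul]
    refine mul_le_mul_of_nonneg_left ?_ (abs_nonneg _)
    exact hM.abs_spaceGen_sub_le hn hC hm₀ hC₀ hv0 hv1 hv2 hsmall hz' l hb0 fun w hw =>
      hM.rate_le hn hm₀ hC₀ (hM.norm_le hn hz') (mem_of_mem_jumps hn hz').2 l hw
  refine (Finset.abs_sum_le_sum_abs _ _).trans ((Finset.sum_le_card_nsmul F _ _ hterm).trans ?_)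
  rw [nsmul_eq_mul]
  have hcard' : (F.card : ℝ) ≤ N₀ := by exact_mod_cast hcard
  refine (mul_le_mul_of_nonneg_right hcard' (by positivity)).trans ?_
  have hratio : M.ratio n x = (n : ℝ) ^ (-(M.α / 2)) * G * (n : ℝ) ^ (-M.β) / (1 + ‖x‖) := rfl
  have harith := averaging_error_arith (a := (n : ℝ) ^ (-(M.α / 2))) (u := (n : ℝ) ^ (M.α / 2))
    (h := (n : ℝ) ^ (-M.β)) (G := G) (m := m₀) (c := C₀) (v := 1 + v x) (s := ‖x‖) hau hα2' hβ hG0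
    hm₀ hC₀ (by linarith) (norm_nonneg x) hu1 (hratio ▸ ratio_le_three hn x)
  rw [hratio]
  have hk : 0 ≤ 2 * (N₀ : ℝ) ^ 2 * τ * C := by positivity
  refine le_trans (le_of_eq ?_) ((mul_le_mul_of_nonneg_left harith hk).trans (le_of_eq ?_))
  · rw [e, hD, hb]
    ring
  · ring

end

end ModulatedModel

/-- The drift condition in terms of the generator gives the drift condition for the jump rates. -/
lemma FosterLyapunov.of_hasSum {S : Type*} {q : S → S → ℝ} {U L : S → ℝ} {c D : ℝ}
    (hq : IsRateMatrix q) (hU : ∀ x, 1 ≤ U x) (hfin : ∀ R, {x | U x ≤ R}.Finite) (hc : 0 < c)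
    (hD : 0 ≤ D) (hL : ∀ x, HasSum (fun y => q x y * (U y - U x)) (L x))
    (hdrift : ∀ x, L x ≤ D - c * U x) : FosterLyapunov q U c D := by
  classical
  have hU0 : ∀ x, 0 ≤ U x := fun x => zero_le_one.trans (hU x)
  have hoff : ∀ x, HasSum (fun y => if y = x then 0 else q x y * U y) (L x - q x x * U x) := by
    intro x
    have h1 := (hL x).add ((hq.row_sum x).mul_right (U x))
    have h2 : HasSum (fun y => q x y * U y) (L x) := by
      have e : (fun y => q x y * U y) = fun y => q x y * (U y - U x) + q x y * U x := by
        funext y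
        ring
      rw [e]
      simpa using h1
    have h3 := h2.update x 0
    have e : (fun y => if y = x then 0 else q x y * U y) =
        Function.update (fun y => q x y * U y) x 0 := by
      funext y
      by_cases hy : y = x <;> simp [hy]
    rw [e, show L x - q x x * U x = 0 - q x x * U x + L x by ring]
    exact h3
  have hterm : ∀ x y, 0 ≤ if y = x then 0 else q x y * U y := by
    intro x y
    split_ifs with h
    · exact le_rfl
    · exact mul_nonneg (hq.offdiag_nonneg x y (Ne.symm h)) (hU0 y)
  refine ⟨hq, hU, hfin, hc, hD, fun x => ?_, fun x => ?_⟩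
  · linarith [(hoff x).nonneg (hterm x), hdrift x]
  · refine le_trans (le_of_eq ?_) (ENNReal.ofReal_le_ofReal
      (show L x - q x x * U x ≤ D - c * U x - q x x * U x by linarith [hdrift x]))
    rw [← (hoff x).tsum_eq, ENNReal.ofReal_tsum_of_nonneg (hterm x) (hoff x).summable]
    refine tsum_congr fun y => ?_
    by_cases hy : y = x
    · simp [jumpRate, hy]
    · simp only [jumpRate, hy, if_false]
      rw [ENNReal.ofReal_mul (hq.offdiag_nonneg x y (Ne.symm hy))]

/-! ### The joint chain on its state space, continuous extension and tightness. -/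

namespace ModulatedModel

variable {d k₀ : ℕ} {M : ModulatedModel d k₀} {xs : ℕ → EuclideanSpace ℝ (Fin d)} {n : ℕ}

lemma countable_hatX (hn : 1 ≤ n) : Countable (M.hatX xs n) :=
  ((M.X_countable n hn).image _).to_subtype

lemma continuous_unscale : Continuous (M.unscale xs n) := by
  unfold unscale
  fun_prop

lemma finite_hatX_inter (hn : 1 ≤ n) {K : Set (EuclideanSpace ℝ (Fin d))} (hK : IsCompact K) :
    (M.hatX xs n ∩ K).Finite := by
  have hfin : (M.X n ∩ M.unscale xs n '' K).Finite := by
    by_contra hinf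
    obtain ⟨x, -, hx⟩ := Set.Infinite.exists_accPt_of_subset_isCompact hinf
      (hK.image continuous_unscale) inter_subset_right
    exact M.X_no_acc n hn x (hx.mono (principal_mono.2 inter_subset_left))
  refine (hfin.image (M.scale xs n)).subset fun x hx => ?_
  exact ⟨M.unscale xs n x, ⟨(mem_hatX_iff hn).1 hx.1, x, hx.2, rfl⟩, scale_unscale hn x⟩

lemma isClosed_and_isDiscrete_hatX (hn : 1 ≤ n) :
    IsClosed (M.hatX xs n) ∧ IsDiscrete (M.hatX xs n) := by
  rw [isClosed_and_discrete_iff]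
  intro x
  obtain ⟨K, hK, hxK⟩ := exists_compact_mem_nhds x
  have hfin : ((M.hatX xs n ∩ K) \ {x}).Finite := (finite_hatX_inter hn hK).subset sdiff_subset
  rw [disjoint_principal_right]
  have h1 : ((M.hatX xs n ∩ K) \ {x})ᶜ ∈ 𝓝 x := hfin.isClosed.isOpen_compl.mem_nhds (by simp)
  refine mem_nhdsWithin.2 ?_
  obtain ⟨u, hu, huo, hxu⟩ := mem_nhds_iff.1 (inter_mem h1 hxK)
  refine ⟨u, huo, hxu, fun y hy hyX => ?_⟩
  exact (hu hy.1).1 ⟨⟨hyX, (hu hy.1).2⟩, hy.2⟩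

/-- Every function on the state space extends continuously. -/
lemma exists_continuous_extension (hn : 1 ≤ n) (f : EuclideanSpace ℝ (Fin d) × Fin k₀ → ℝ) :
    ∃ g : EuclideanSpace ℝ (Fin d) × Fin k₀ → ℝ, Continuous g ∧
      ∀ x ∈ M.hatX xs n, ∀ k, g (x, k) = f (x, k) := by
  obtain ⟨hcl, hdisc⟩ := isClosed_and_isDiscrete_hatX (M := M) (xs := xs) hn
  have := hdisc.to_subtype
  have h1 : ∀ k, ∃ g : EuclideanSpace ℝ (Fin d) → ℝ, Continuous g ∧
      ∀ x ∈ M.hatX xs n, g x = f (x, k) := by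
    intro k
    obtain ⟨g, hg⟩ := ContinuousMap.exists_restrict_eq hcl
      (⟨fun x => f (x, k), continuous_of_discreteTopology⟩ : C(M.hatX xs n, ℝ))
    refine ⟨g, g.continuous, fun x hx => ?_⟩
    exact DFunLike.congr_fun hg ⟨x, hx⟩
  choose g hg hgf using h1
  exact ⟨fun p => g p.2 p.1, continuous_prod_of_discrete_right.2 hg, fun x hx k => hgf k x hx⟩

lemma jointGen_congr (hn : 1 ≤ n) {f g : EuclideanSpace ℝ (Fin d) × Fin k₀ → ℝ}
    (h : ∀ x ∈ M.hatX xs n, ∀ k, f (x, k) = g (x, k)) {x : EuclideanSpace ℝ (Fin d)}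
    (hx : x ∈ M.hatX xs n) (k : Fin k₀) : M.jointGen xs n f x k = M.jointGen xs n g x k := by
  have h1 : M.spaceGen xs n k (fun y => f (y, k)) x = M.spaceGen xs n k (fun y => g (y, k)) x :=
    spaceGen_congr hn hx fun y hy => h y hy k
  have h2 : ∀ l, f (x, l) = g (x, l) := h x hx
  unfold jointGen
  simp only [h2]
  exact congrArg (· + _) (by simpa only [spaceGen, h2] using h1)

/-- The two parts of the rate matrix live on the slices with fixed regime and fixed position, so the
sum over pairs splits into two sums over slices. -/
lemma hasSum_jointRate_mul (p : M.hatX xs n × Fin k₀) (g : M.hatX xs n × Fin k₀ → ℝ) {a : ℝ}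
    (h : HasSum (fun y : M.hatX xs n =>
      M.r n p.2 (M.unscale xs n p.1) (M.unscale xs n y) * g (y, p.2)) a) :
    HasSum (fun p' => M.jointRate xs n p p' * g p')
      (a + ∑ l, (n : ℝ) ^ M.α * M.Q p.2 l * g (p.1, l)) := by
  classical
  have h1 : HasSum (fun p' : M.hatX xs n × Fin k₀ => (if p.2 = p'.2 then
      M.r n p.2 (M.unscale xs n p.1) (M.unscale xs n p'.1) else 0) * g p') a := by
    rw [← Function.Injective.hasSum_iff (g := fun y : M.hatX xs n => (y, p.2))]
    · convert h using 2 with y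
      simp
    · intro y y' hy
      exact (Prod.mk.inj hy).1
    · rintro ⟨y, l⟩ hy
      have : p.2 ≠ l := fun e => hy ⟨y, by rw [e]⟩
      simp [this]
  have h2 : HasSum (fun p' : M.hatX xs n × Fin k₀ => (if p.1 = p'.1 then
      (n : ℝ) ^ M.α * M.Q p.2 p'.2 else 0) * g p') (∑ l, (n : ℝ) ^ M.α * M.Q p.2 l * g (p.1, l)) := by
    rw [← Function.Injective.hasSum_iff (g := fun l : Fin k₀ => (p.1, l))]
    · convert hasSum_fintype (fun l => (n : ℝ) ^ M.α * M.Q p.2 l * g (p.1, l)) using 2 with l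
      simp
    · intro y y' hy
      exact (Prod.mk.inj hy).2
    · rintro ⟨y, l⟩ hy
      have : p.1 ≠ y := fun e => hy ⟨l, by rw [e]⟩
      simp [this]
  convert h1.add h2 using 2 with p'
  rw [jointRate, add_mul]

/-- The state space of the scaled process is in bijection with that of the unscaled one. -/
noncomputable def hatXEquiv (xs : ℕ → EuclideanSpace ℝ (Fin d)) (hn : 1 ≤ n) :
    M.hatX xs n ≃ M.X n where
  toFun y := ⟨M.unscale xs n y, (mem_hatX_iff hn).1 y.2⟩
  invFun x := ⟨M.scale xs n x, x, x.2, rfl⟩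
  left_inv _ := Subtype.ext (scale_unscale hn _)
  right_inv _ := Subtype.ext (unscale_scale hn _)

lemma isRateMatrix_jointRate (hn : 1 ≤ n) : IsRateMatrix (M.jointRate xs n) := by
  have hα := scale_pow_pos hn M.α
  refine ⟨fun p p' hpp' => ?_, fun p => ?_⟩
  · refine add_nonneg ?_ ?_
    · split_ifs with h
      · refine (M.r_rate n hn p.2).offdiag_nonneg (hatXEquiv xs hn p.1) (hatXEquiv xs hn p'.1) ?_
        exact fun e => hpp' (Prod.ext ((hatXEquiv xs hn).injective e) h)
      · exact le_rfl
    · split_ifs with h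
      · exact mul_nonneg hα.le (M.Q_rate.offdiag_nonneg _ _ fun e => hpp' (Prod.ext h e))
      · exact le_rfl
  · have h := hasSum_jointRate_mul (xs := xs) p (fun _ => 1) (a := 0) (by
      have := (hatXEquiv xs hn).hasSum_iff.2 ((M.r_rate n hn p.2).row_sum (hatXEquiv xs hn p.1))
      simp only [mul_one]
      exact this)
    have e : ∑ l, (n : ℝ) ^ M.α * M.Q p.2 l = 0 := by
      rw [← Finset.mul_sum, M.Q_rate.sum_row, mul_zero]
    simpa only [mul_one, e, add_zero] using h

/-- First the position moves with the regime frozen, then the regime switches with the position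
frozen. -/
lemma isIrreducibleRate_jointRate (hn : 1 ≤ n) : IsIrreducibleRate (M.jointRate xs n) := by
  have hα := scale_pow_pos hn M.α
  rintro ⟨x, i⟩ ⟨y, j⟩
  have h1 : Relation.ReflTransGen (fun a b => 0 < M.jointRate xs n a b) (x, i) (y, i) := by
    have h := (M.r_irred n hn i (hatXEquiv xs hn x) (hatXEquiv xs hn y)).lift
      (p := fun a b => 0 < M.jointRate xs n a b) (fun a => ((hatXEquiv xs hn).symm a, i))
      (fun a b hab => by
        have hne : a ≠ b := by
          rintro rfl
          exact not_le.2 hab ((M.r_rate n hn i).diag_nonpos a)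
        have hne' : (hatXEquiv xs hn).symm a ≠ (hatXEquiv xs hn).symm b :=
          fun e => hne ((hatXEquiv xs hn).symm.injective e)
        have ha : M.unscale xs n ((hatXEquiv xs hn).symm a) = a := unscale_scale hn _
        have hb : M.unscale xs n ((hatXEquiv xs hn).symm b) = b := unscale_scale hn _
        change 0 < M.jointRate xs n ((hatXEquiv xs hn).symm a, i) ((hatXEquiv xs hn).symm b, i)
        simp only [jointRate, if_true, hne', if_false, add_zero, ha, hb]
        exact hab)
    simpa [Function.onFun] using h
  refine h1.trans ?_
  refine (M.Q_irred i j).lift (fun l => (y, l)) fun a b hab => ?_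
  have hne : a ≠ b := by
    rintro rfl
    exact not_le.2 hab (M.Q_rate.diag_nonpos a)
  change 0 < M.jointRate xs n (y, a) (y, b)
  simp only [jointRate, hne, if_false, if_true, zero_add]
  exact mul_pos hα hab

variable {m₀ C₀ : ℝ} {N₀ : ℕ}

lemma Structural.hasSum_spaceGen (hM : M.Structural xs m₀ N₀ C₀) (hn : 1 ≤ n) (k : Fin k₀)
    (f : EuclideanSpace ℝ (Fin d) → ℝ) (x : M.hatX xs n) :
    HasSum (fun y : M.hatX xs n => M.r n k (M.unscale xs n x) (M.unscale xs n y) * (f y - f x))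
      (M.spaceGen xs n k f x) := by
  obtain ⟨F, hF, -⟩ := hM.exists_finset hn k ((mem_hatX_iff hn).1 x.2)
  have hsupp : Function.support (fun y => M.r n k (M.unscale xs n x) (M.unscale xs n y) *
      (f y - f x)) ⊆ M.hatX xs n := by
    intro y hy
    rw [mem_hatX_iff hn]
    by_contra h
    exact hy (by simp only [M.r_zero n hn k _ _ fun h' => h h'.2, zero_mul])
  refine (hasSum_subtype_iff_of_support_subset hsupp).2 ?_
  let e : EuclideanSpace ℝ (Fin d) ≃ EuclideanSpace ℝ (Fin d) :=
    (Homeomorph.smulOfNeZero ((n : ℝ) ^ (-M.β)) (scale_pow_pos hn _).ne').toEquiv.trans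
      (Equiv.addLeft (x : EuclideanSpace ℝ (Fin d)))
  have he : ∀ z, e z = x + (n : ℝ) ^ (-M.β) • z := fun z => rfl
  rw [← e.hasSum_iff, spaceGen_eq_sum hn hF.ge]
  have := hasSum_sum_of_ne_finset_zero (L := .unconditional _) (s := F) (f := fun z =>
    M.r n k (M.unscale xs n x) (M.unscale xs n x + z) * (f (x + (n : ℝ) ^ (-M.β) • z) - f x)) ?_
  · convert this using 2 with z
    simp only [Function.comp_apply, he, unscale_add_smul hn]
  · intro z hz
    by_cases hz0 : z = 0
    · simp [hz0]
    · rw [r_eq_zero hn hz0, zero_mul]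
      rw [← hF]
      exact hz

lemma Structural.hasSum_jointGen (hM : M.Structural xs m₀ N₀ C₀) (hn : 1 ≤ n)
    (f : EuclideanSpace ℝ (Fin d) × Fin k₀ → ℝ) (p : M.hatX xs n × Fin k₀) :
    HasSum (fun p' => M.jointRate xs n p p' * (f (p'.1, p'.2) - f (p.1, p.2)))
      (M.jointGen xs n f p.1 p.2) :=
  hasSum_jointRate_mul p (fun p' => f (p'.1, p'.2) - f (p.1, p.2))
    (hM.hasSum_spaceGen hn p.2 (fun y => f (y, p.2)) p.1)

lemma invariantMeasures_apply {μ : PMF (M.hatX xs n × Fin k₀)}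
    {A : Set (EuclideanSpace ℝ (Fin d) × Fin k₀)} (hA : MeasurableSet A) :
    (μ.map fun p => ((p.1 : EuclideanSpace ℝ (Fin d)), p.2)).toMeasure A =
      ∑' p, {p : M.hatX xs n × Fin k₀ | ((p.1 : EuclideanSpace ℝ (Fin d)), p.2) ∈ A}.indicator
        μ p := by
  rw [PMF.toMeasure_apply_eq_toOuterMeasure_apply _ hA, PMF.toOuterMeasure_map_apply,
    PMF.toOuterMeasure_apply]
  rfl

/-- A family of chains with uniform drift conditions has a tight family of invariant laws. -/
lemma isTightMeasureSet_invariantMeasures {I : Set ℕ}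
    {U : ∀ n, M.hatX xs n × Fin k₀ → ℝ} {c D : ℝ}
    (hU : ∀ n ∈ I, Countable (M.hatX xs n) ∧ FosterLyapunov (M.jointRate xs n) (U n) c D)
    (hinf : ∀ A : ℝ, ∃ R : ℝ, ∀ n ∈ I, ∀ p, R ≤ ‖(p.1 : EuclideanSpace ℝ (Fin d))‖ → A < U n p) :
    IsTightMeasureSet (⋃ n ∈ I, M.invariantMeasures xs n) := by
  rw [isTightMeasureSet_iff_exists_isCompact_measure_compl_le]
  intro ε hε
  have hlim : Tendsto (fun R : ℝ => ENNReal.ofReal (D / c / R)) atTop (𝓝 (ENNReal.ofReal 0)) :=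
    ENNReal.tendsto_ofReal (tendsto_const_nhds.div_atTop tendsto_id)
  rw [ENNReal.ofReal_zero] at hlim
  obtain ⟨R, hRε, hR⟩ := ((hlim.eventually (eventually_le_nhds hε)).and
    (eventually_gt_atTop 0)).exists
  obtain ⟨ρ, hρ⟩ := hinf R
  refine ⟨Metric.closedBall 0 ρ ×ˢ univ, (isCompact_closedBall 0 ρ).prod isCompact_univ,
    fun ν hν => ?_⟩
  simp only [mem_iUnion] at hν
  obtain ⟨n, hnI, μ, hμ, rfl⟩ := hν
  obtain ⟨hcount, hFL⟩ := hU n hnI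
  rw [invariantMeasures_apply
    ((Metric.isClosed_closedBall.measurableSet).prod MeasurableSet.univ).compl]
  refine le_trans (ENNReal.tsum_le_tsum fun p => ?_) ((hFL.invariantLaw_tail_le hμ hR).trans hRε)
  refine indicator_le_indicator_of_subset (fun p hp => ?_) (fun _ => zero_le) p
  refine hρ n hnI p ?_
  by_contra h
  refine hp ⟨?_, mem_univ _⟩
  rw [mem_closedBall_zero_iff]
  exact (not_le.1 h).le

lemma finite_sublevel (hn : 1 ≤ n) {v : EuclideanSpace ℝ (Fin d) → ℝ}
    (hv : Tendsto v (cocompact (EuclideanSpace ℝ (Fin d))) atTop) (R : ℝ) :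
    {p : M.hatX xs n × Fin k₀ | v p.1 ≤ R}.Finite := by
  obtain ⟨K, hK, hKv⟩ := mem_cocompact.1 (hv (Ioi_mem_atTop R))
  have hfin : {x : M.hatX xs n | v x ≤ R}.Finite := by
    refine Finite.of_finite_image ((finite_hatX_inter (M := M) (xs := xs) hn hK).subset ?_)
      Subtype.val_injective.injOn
    rintro _ ⟨x, hx, rfl⟩
    refine ⟨x.2, ?_⟩
    by_contra h
    exact not_le.2 (show R < v x from hKv h) hx
  refine (hfin.prod (finite_univ (α := Fin k₀))).subset fun p hp => ⟨hp, mem_univ _⟩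

end ModulatedModel

namespace ModulatedModel

variable {d k₀ : ℕ} {M : ModulatedModel d k₀} {xs : ℕ → EuclideanSpace ℝ (Fin d)} {n : ℕ}
  {m₀ C₀ : ℝ} {N₀ : ℕ}

/-- A drift condition for the generator of the joint process is a Foster–Lyapunov condition for its
rate matrix. -/
lemma Structural.fosterLyapunov (hM : M.Structural xs m₀ N₀ C₀) (hn : 1 ≤ n)
    {v : EuclideanSpace ℝ (Fin d) → ℝ} {w : EuclideanSpace ℝ (Fin d) × Fin k₀ → ℝ} {D₁ D₂ : ℝ}
    (hD₁ : 0 ≤ D₁) (hD₂ : 0 < D₂) (hv0 : ∀ x, 0 ≤ v x)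
    (hv : Tendsto v (cocompact (EuclideanSpace ℝ (Fin d))) atTop)
    (hvw : ∀ x ∈ M.hatX xs n, ∀ k, 1 / 2 * (v x - 1) ≤ w (x, k))
    (hdrift : ∀ x ∈ M.hatX xs n, ∀ k, M.jointGen xs n w x k ≤ D₁ - D₂ * w (x, k)) :
    FosterLyapunov (M.jointRate xs n)
      (fun p : M.hatX xs n × Fin k₀ => w (p.1, p.2) + 3 / 2) D₂ (D₁ + 3 / 2 * D₂) := by
  -- Since `w ≥ -1/2`, adding `3/2` makes the function at least one; the drift constant grows by
  -- `3/2 * D₂`.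
  refine FosterLyapunov.of_hasSum (isRateMatrix_jointRate hn) (fun p => ?_) (fun R => ?_) hD₂
    (by positivity) (L := fun p => M.jointGen xs n w p.1 p.2) (fun p => ?_) fun p => ?_
  · linarith [hvw p.1 p.1.2 p.2, hv0 p.1]
  · refine (finite_sublevel (M := M) (xs := xs) hn hv (2 * R)).subset fun p hp => ?_
    have hp' : w (p.1, p.2) + 3 / 2 ≤ R := hp
    have := hvw p.1 p.1.2 p.2
    change v p.1 ≤ 2 * R
    linarith
  · simpa only [add_sub_add_right_eq_sub] using hM.hasSum_jointGen hn w p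
  · linarith [hdrift p.1 p.1.2 p.2]

end ModulatedModel

/-! ### Choice of constants and conclusion. -/

theorem theorem2p1 {d k₀ : ℕ} (M : ModulatedModel d k₀)
    (xs : ℕ → EuclideanSpace ℝ (Fin d)) (m₀ : ℝ) (N₀ : ℕ) (C₀ : ℝ)
    (hm₀ : 0 < m₀) (hN₀ : 0 < N₀) (hC₀ : 0 < C₀) (hM : M.Structural xs m₀ N₀ C₀)
    (V : ℕ → EuclideanSpace ℝ (Fin d) → ℝ)
    (hVcont : ∀ n, 1 ≤ n → Continuous (V n))
    (hVnonneg : ∀ n, 1 ≤ n → ∀ x, 0 ≤ V n x)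
    (hVnorm : ∀ n, 1 ≤ n → Tendsto (V n) (cocompact (EuclideanSpace ℝ (Fin d))) atTop)
    (n₀ : ℕ) (ε₀ C C₁ C₂ : ℝ) (hε₀ : 0 < ε₀) (hC : 0 < C) (hC₁ : 0 < C₁) (hC₂ : 0 < C₂)
    (hV1 : ∀ n, 1 ≤ n → ∀ x y : EuclideanSpace ℝ (Fin d), 0 < ‖y‖ → ‖y‖ < ε₀ →
      (1 + ‖x‖) * |V n (x + y) - V n x| ≤ C * ‖y‖ * (1 + V n x))
    (hV2 : ∀ n, 1 ≤ n → ∀ x y z : EuclideanSpace ℝ (Fin d),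
      0 < ‖y‖ → ‖y‖ < ε₀ → 0 < ‖z‖ → ‖z‖ < ε₀ →
      (1 + ‖x‖ ^ 2) * |V n (x + y + z) - V n (x + y) - V n (x + z) + V n x| ≤
        C * ‖y‖ * ‖z‖ * (1 + V n x))
    (hdrift : ∀ n, 1 ≤ n → n₀ < n → ∀ x ∈ M.hatX xs n,
      M.avgGen xs n (V n) x ≤ C₁ - C₂ * V n x)
    (hV0 : M.α ≤ 1 → ∃ A : ℝ, ∀ n, 1 ≤ n → V n 0 ≤ A) :
    ∃ (W : ℕ → EuclideanSpace ℝ (Fin d) × Fin k₀ → ℝ) (D₁ D₂ : ℝ) (n₁ : ℕ),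
      (∀ n, Continuous (W n)) ∧ 0 < D₁ ∧ 0 < D₂ ∧ 1 ≤ n₁ ∧
      (∀ n, n₁ ≤ n → ∀ x ∈ M.hatX xs n, ∀ k,
        (1 / 2) * (V n x - 1) ≤ W n (x, k) ∧ W n (x, k) ≤ (3 / 2) * V n x + 1 / 2) ∧
      (∀ n, n₁ < n → ∀ x ∈ M.hatX xs n, ∀ k,
        M.jointGen xs n (W n) x k ≤ D₁ - D₂ * W n (x, k)) ∧
      (∀ n, n₁ < n → IsExponentiallyErgodic (M.jointRate xs n)) ∧
      ((∀ A : ℝ, ∃ R : ℝ, ∀ n, 1 ≤ n → ∀ x, R ≤ ‖x‖ → A ≤ V n x) →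
        IsTightMeasureSet (⋃ n ∈ Set.Ioi n₁, M.invariantMeasures xs n)) := by
  classical
  obtain ⟨T, hT⟩ := exists_poisson M.Q_rate M.Q_irred M.π_sum M.π_inv
  set K₁ := (∑ k, ∑ l, |T k l|) * N₀ * C₀ * (1 + m₀) * C * m₀ with hK₁
  set K₂ := 2 * (N₀ : ℝ) ^ 2 * (∑ k, ∑ l, |T k l|) * C *
    ((C₀ * (1 + m₀)) ^ 2 * (6 * m₀ ^ 2 + m₀)) with hK₂
  have hτ : 0 ≤ ∑ k, ∑ l, |T k l| :=
    Finset.sum_nonneg fun _ _ => Finset.sum_nonneg fun _ _ => abs_nonneg _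
  have hK₁0 : 0 ≤ K₁ := by positivity
  have hK₂0 : 0 ≤ K₂ := by positivity
  -- This `δ` satisfies `K₂ δ ≤ C₂ / 2`, so the averaging error consumes at most half of the drift;
  -- the `+ 1` covers `K₂ = 0`.
  obtain ⟨B, na, hB0, hB⟩ := ModulatedModel.exists_ratio_mul_le (M := M) hε₀ hC.le hVnonneg hV1 hV0
    (δ := C₂ / (2 * (K₂ + 1))) (by positivity)
  have hβ : 0 < M.β := lt_of_lt_of_le (by norm_num) (le_max_left _ _)
  have hlim1 : Tendsto (fun n : ℕ => (n : ℝ) ^ (-M.β) * m₀) atTop (𝓝 0) := by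
    simpa using (ModulatedModel.tendsto_natCast_rpow (a := -M.β) (by linarith)).mul_const m₀
  obtain ⟨nb, hnb⟩ := eventually_atTop.1 (hlim1.eventually (eventually_lt_nhds hε₀))
  have hlim2 : Tendsto (fun n : ℕ => K₁ * ((n : ℝ) ^ (-(M.α / 2)) * 3)) atTop (𝓝 0) := by
    simpa using ((ModulatedModel.tendsto_natCast_rpow (a := -(M.α / 2))
      (by linarith [M.α_pos])).mul_const 3).const_mul K₁
  obtain ⟨nc, hnc⟩ := eventually_atTop.1
    (hlim2.eventually (eventually_le_nhds (show (0 : ℝ) < 1 / 2 by norm_num)))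
  have hext : ∀ n, ∃ w : EuclideanSpace ℝ (Fin d) × Fin k₀ → ℝ, Continuous w ∧
      (1 ≤ n → ∀ x ∈ M.hatX xs n, ∀ k, w (x, k) = M.corrector xs T n (V n) (x, k)) := by
    intro n
    by_cases hn : 1 ≤ n
    · obtain ⟨w, hw, hw'⟩ := ModulatedModel.exists_continuous_extension (M := M) (xs := xs) hn
        (M.corrector xs T n (V n))
      exact ⟨w, hw, fun _ => hw'⟩
    · exact ⟨fun _ => 0, continuous_const, fun h => absurd h hn⟩
  choose W hWcont hW using hext
  set n₁ := max 1 (max n₀ (max na (max nb nc))) with hn₁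
  have hn₁' : ∀ n, n₁ ≤ n → 1 ≤ n ∧ n₀ ≤ n ∧ na ≤ n ∧ nb ≤ n ∧ nc ≤ n := by
    intro n hn
    simpa [hn₁] using hn
  have hbound : ∀ n, n₁ ≤ n → ∀ x ∈ M.hatX xs n, ∀ k,
      1 / 2 * (V n x - 1) ≤ W n (x, k) ∧ W n (x, k) ≤ 3 / 2 * V n x + 1 / 2 := by
    intro n hn x hx k
    obtain ⟨h1, -, -, h4, h5⟩ := hn₁' n hn
    have hv := hVnonneg n h1 x
    have hcorr := hM.abs_correction_le T h1 hC.le hm₀.le hC₀.le (hVnonneg n h1) (hV1 n h1)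
      (hnb n h4) hx k
    have hle : K₁ * ((n : ℝ) ^ (-(M.α / 2)) * M.ratio n x * (1 + V n x)) ≤
        1 / 2 * (1 + V n x) := by
      have e1 : (n : ℝ) ^ (-(M.α / 2)) * M.ratio n x ≤ (n : ℝ) ^ (-(M.α / 2)) * 3 :=
        mul_le_mul_of_nonneg_left (ModulatedModel.ratio_le_three h1 x)
          (ModulatedModel.scale_pow_pos h1 _).le
      have e2 := (mul_le_mul_of_nonneg_left e1 hK₁0).trans (hnc n h5)
      calc _ = K₁ * ((n : ℝ) ^ (-(M.α / 2)) * M.ratio n x) * (1 + V n x) := by ring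
        _ ≤ _ := mul_le_mul_of_nonneg_right e2 (by linarith)
    have hcorr' := abs_le.1 (hcorr.trans hle)
    rw [hW n h1 x hx k]
    simp only [ModulatedModel.corrector]
    constructor <;> linarith [hcorr'.1, hcorr'.2]
  -- The surviving drift `-(C₂ / 2) V` becomes `-(C₂ / 3) W + C₂ / 6` through `W ≥`-free use of the
  -- upper comparison `W ≤ (3/2) V + 1/2`.
  have hgen : ∀ n, n₁ < n → ∀ x ∈ M.hatX xs n, ∀ k,
      M.jointGen xs n (W n) x k ≤
        C₁ + C₂ / 2 + K₂ * B + C₂ / 6 - C₂ / 3 * W n (x, k) := by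
    intro n hn x hx k
    obtain ⟨h1, h2, h3, h4, h5⟩ := hn₁' n hn.le
    have hn₀ : n₀ < n := lt_of_le_of_lt (hn₁' n₁ le_rfl).2.1 hn
    have hv := hVnonneg n h1 x
    rw [ModulatedModel.jointGen_congr h1 (hW n h1) hx k, hM.jointGen_corrector h1 hT _ hx]
    have herr := hM.abs_averaging_error_le T h1 hC.le hm₀.le hC₀.le (hVnonneg n h1) (hV1 n h1)
      (hV2 n h1) (hnb n h4) hx k
    have hδ : K₂ * (C₂ / (2 * (K₂ + 1))) ≤ C₂ / 2 := by
      rw [show K₂ * (C₂ / (2 * (K₂ + 1))) = K₂ * C₂ / (2 * (K₂ + 1)) by ring,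
        div_le_iff₀ (by positivity)]
      nlinarith
    have h6 := mul_le_mul_of_nonneg_left (hB n h1 h3 x) hK₂0
    have h7 := mul_le_mul_of_nonneg_right hδ (show 0 ≤ 1 + V n x by linarith)
    have h8 := mul_le_mul_of_nonneg_left (hbound n hn.le x hx k).2 (show 0 ≤ C₂ / 3 by positivity)
    have h9 := (le_abs_self _).trans herr
    linarith [hdrift n h1 hn₀ x hx]
  have hFL : ∀ n, n₁ < n → FosterLyapunov (M.jointRate xs n)
      (fun p : M.hatX xs n × Fin k₀ => W n (p.1, p.2) + 3 / 2) (C₂ / 3)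
      (C₁ + C₂ / 2 + K₂ * B + C₂ / 6 + 3 / 2 * (C₂ / 3)) := by
    intro n hn
    have h1 := (hn₁' n hn.le).1
    exact hM.fosterLyapunov h1 (by positivity) (by positivity) (hVnonneg n h1) (hVnorm n h1)
      (fun x hx k => (hbound n hn.le x hx k).1) (hgen n hn)
  refine ⟨W, C₁ + C₂ / 2 + K₂ * B + C₂ / 6, C₂ / 3, n₁, hWcont, by positivity, by positivity,
    le_max_left _ _, hbound, hgen, fun n hn => ?_, fun hinf => ?_⟩
  · have h1 := (hn₁' n hn.le).1
    have := ModulatedModel.countable_hatX (M := M) (xs := xs) h1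
    have hne : Nonempty (M.hatX xs n) := ((M.X_nonempty n h1).image _).to_subtype
    have hk : Nonempty (Fin k₀) := by
      by_contra h
      rw [not_nonempty_iff] at h
      simpa using M.π_sum
    exact (hFL n hn).isExponentiallyErgodic (ModulatedModel.isIrreducibleRate_jointRate h1)
  · refine ModulatedModel.isTightMeasureSet_invariantMeasures (fun n hn =>
      ⟨ModulatedModel.countable_hatX (hn₁' n (le_of_lt hn)).1, hFL n hn⟩) fun A => ?_
    -- From `V ≥ 2 A` the lower comparison gives `W + 3/2 ≥ A + 1 > A`.
    obtain ⟨R, hR⟩ := hinf (2 * A)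
    refine ⟨R, fun n hn p hp => ?_⟩
    have h1 := hR n (hn₁' n (le_of_lt hn)).1 p.1 hp
    have h2 := (hbound n (le_of_lt hn) p.1 p.1.2 p.2).1
    linarith
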